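/- Let $\mathcal O$ be either an algebraically closed field $k$ of characteristic $2$, or a complete discrete valuation ring of characteristic $0$ whose residue field $k$ is algebraically closed of characteristic $2$. Let $G$ be a finite group, let $\Sigma=\langle\sigma\rangle$ be cyclic of order $2$, and let $G\wr\Sigma=(G\times G)\rtimes\Sigma$, where $\sigma$ interchanges the two factors. The group algebra $\mathcal OG$ is a right $\mathcal O(G\wr\Sigma)$-module via $a\cdot(g_1,g_2)=g_1^{-1}ag_2$ for $a\in\mathcal OG$, $g_1,g_2\in G$, and $g^\sigma=g^{-1}$ for $g\in G$, extended linearly. For $g\in G$ write $\underline g=(g,g)\in G\times G$, and $\underline D=\{\underline d\mid d\in D\}$ for $D\le G$. Let $B=e\,\mathcal OG$ be a block of $\mathcal OG$, where $e$ is a primitive idempotent of the centre of $\mathcal OG$. Put $B^o=\{b^\sigma\mid b\in B\}$, and call $B$ real if $B=B^o$. Say that $B$ has defect zero if the $k$-algebra $\bar e\,kG$ is simple, where $\bar e$ is the image of $e$ in $kG$. Let $D$ be a defect group of $B$, that is, a subgroup of $G$ minimal subject to $e=\sum_{gD\in G/D}gag^{-1}$ for some $a\in\mathcal OG$ fixed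 under conjugation by $D$. Then $B+B^o$ is an $\mathcal O(G\wr\Sigma)$-submodule of $\mathcal OG$ (equal to $B$ if $B$ is real), it is indecomposable, and the following hold. Here a vertex of an indecomposable module $M$ is a subgroup $V$ minimal subject to $M$ being isomorphic to a direct summand of $(M{\downarrow_V}){\uparrow^{G\wr\Sigma}}$. 1. If $B$ is not real, then $\underline D$ is a vertex of $B+B^o$. 2. If $B$ is real, then there exists $x\in N_G(D)$ with $x^2\in D$ such that $\underline D\langle\underline x\,\sigma\rangle$ is a vertex of $B$. 3. $\Sigma$ is a vertex of $B+B^o$ if and only if $B$ is real and has defect zero. -/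

import Mathlib

open scoped MonoidAlgebra

noncomputable section

namespace BlockVertex

/-! ### Relative projectivity and vertices -/

section Vertex

variable {A Γ M : Type*} [CommRing A] [Group Γ] [AddCommGroup M] [Module A M]

/-- A representation is indecomposable if it is nonzero and is not the direct sum of two nonzero
subrepresentations. -/
def IsIndecomposable (ρ : Representation A Γ M) : Prop :=
  Nontrivial M ∧ ∀ N₁ N₂ : Subrepresentation ρ, IsCompl N₁ N₂ → N₁ = ⊥ ∨ N₂ = ⊥

/-- `ρ` is isomorphic to a direct summand of `τ`. -/
def IsDirectSummand {N : Type*} [AddCommGroup N] [Module A N]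
    (ρ : Representation A Γ M) (τ : Representation A Γ N) : Prop :=
  ∃ (i : Representation.IntertwiningMap ρ τ) (p : Representation.IntertwiningMap τ ρ),
    p.toLinearMap ∘ₗ i.toLinearMap = LinearMap.id

/-- `ρ` is relatively `H`-projective: it is a direct summand of the module obtained by
restricting `ρ` to `H` and inducing the result back to the whole group. -/
def IsRelProjective (ρ : Representation A Γ M) (H : Subgroup Γ) : Prop :=
  IsDirectSummand ρ (Representation.ind H.subtype (ρ.comp H.subtype))

/-- `V` is a vertex of the indecomposable representation `ρ`: a minimal subgroup relative to which
`ρ` is projective. -/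
structure IsVertex (ρ : Representation A Γ M) (V : Subgroup Γ) : Prop where
  indecomposable : IsIndecomposable ρ
  minimal : Minimal (fun H : Subgroup Γ => IsRelProjective ρ H) V

end Vertex

/-! ### The wreath product of `G` with a group of order two -/

section Wreath

variable (G : Type*) [Group G]

/-- The cyclic group of order two. -/
abbrev Sigma2 : Type := Multiplicative (ZMod 2)

/-- The generator of the group of order two. -/
def sgen : Sigma2 := Multiplicative.ofAdd 1

/-- The group of order two acts on `G × G` by interchanging the two factors. -/
def swapHom : Sigma2 →* MulAut (G × G) where
  toFun s := if s = 1 then 1 else MulEquiv.prodComm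
  map_one' := by simp
  map_mul' s t := by
    have key : ∀ u : Sigma2, u = 1 ∨ u = sgen := by decide
    have h1 : sgen ≠ 1 := by decide
    have h2 : sgen * sgen = 1 := by decide
    rcases key s with rfl | rfl <;> rcases key t with rfl | rfl
    · simp
    · simp
    · simp
    · ext x <;> simp [h1, h2]

/-- The wreath product: the semidirect product of `G × G` with the group of order two, which
interchanges the two factors. -/
abbrev Wreath : Type _ := (G × G) ⋊[swapHom G] Sigma2

variable {G}

/-- The involution `σ` of the wreath product. -/
def sigma : Wreath G := SemidirectProduct.inr sgen

variable (G) in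
/-- The subgroup of order two generated by `σ`. -/
def SigmaSubgroup : Subgroup (Wreath G) := Subgroup.zpowers sigma

/-- The diagonal embedding `g ↦ (g, g)` of `G` into the wreath product. -/
def diag : G →* Wreath G :=
  SemidirectProduct.inl.comp ((MonoidHom.id G).prod (MonoidHom.id G))

/-- The permutation of `G` given by an element of the wreath product: `(g₁, g₂)` acts as
`x ↦ g₁ x g₂⁻¹`, and `(g₁, g₂) σ` acts as `x ↦ g₁ x⁻¹ g₂⁻¹`. -/
def wreathPerm (w : Wreath G) (x : G) : G :=
  w.left.1 * (if w.right = 1 then x else x⁻¹) * w.left.2⁻¹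

lemma wreathPerm_mul (v w : Wreath G) :
    wreathPerm (v * w) = wreathPerm v ∘ wreathPerm w := by
  have key : ∀ u : Sigma2, u = 1 ∨ u = sgen := by decide
  have h1 : sgen ≠ 1 := by decide
  have h2 : sgen * sgen = 1 := by decide
  obtain ⟨⟨a, b⟩, s⟩ := v
  obtain ⟨⟨c, d⟩, t⟩ := w
  funext x
  change (((a, b) : G × G) * swapHom G s (c, d)).1 * (if s * t = 1 then x else x⁻¹) *
      (((a, b) : G × G) * swapHom G s (c, d)).2⁻¹ =
    a * (if s = 1 then (c * (if t = 1 then x else x⁻¹) * d⁻¹)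
      else (c * (if t = 1 then x else x⁻¹) * d⁻¹)⁻¹) * b⁻¹
  rcases key s with rfl | rfl <;> rcases key t with rfl | rfl <;>
    simp [swapHom, h1, h2, mul_assoc]

/-- The group algebra `O[G]` as a module for the wreath product: the base group acts by
`(g₁, g₂) · x = g₁ x g₂⁻¹`, and `σ` acts by the linear extension of `g ↦ g⁻¹`. -/
def wreathRep (O G : Type*) [CommRing O] [Group G] : Representation O (Wreath G) O[G] where
  toFun w := MonoidAlgebra.mapDomainLinearMap O O (wreathPerm w)
  map_one' := by
    ext x
    simp [wreathPerm]
  map_mul' v w := by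
    rw [wreathPerm_mul, MonoidAlgebra.mapDomainLinearMap_comp]
    rfl

variable {O : Type*} [CommRing O]

lemma wreathRep_inl (a b : G) (x : O[G]) :
    wreathRep O G (SemidirectProduct.inl (a, b)) x =
      MonoidAlgebra.of O G a * x * MonoidAlgebra.of O G b⁻¹ := by
  have h : (wreathRep O G (SemidirectProduct.inl (a, b)) : O[G] →ₗ[O] O[G]) =
      LinearMap.mulRight O (MonoidAlgebra.of O G b⁻¹) ∘ₗ
        LinearMap.mulLeft O (MonoidAlgebra.of O G a) := by
    ext g
    simp [wreathRep, wreathPerm, MonoidAlgebra.single_mul_single]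
  exact congrArg (fun f : O[G] →ₗ[O] O[G] => f x) h

lemma wreathRep_sigma_single (g : G) (c : O) :
    wreathRep O G sigma (MonoidAlgebra.single g c) = MonoidAlgebra.single g⁻¹ c := by
  have h1 : sgen ≠ 1 := by decide
  simp [wreathRep, wreathPerm, sigma, h1]

end Wreath

/-! ### Blocks and their defect groups -/

section Block

variable {O G : Type*} [CommRing O] [Group G]

/-- A block idempotent: a primitive idempotent of the centre of the group algebra. -/
structure IsBlockIdempotent (e : O[G]) : Prop where
  central : e ∈ Subalgebra.center O O[G]
  idem : IsIdempotentElem e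
  ne_zero : e ≠ 0
  primitive : ∀ f₁ ∈ Subalgebra.center O O[G], ∀ f₂ ∈ Subalgebra.center O O[G],
    IsIdempotentElem f₁ → IsIdempotentElem f₂ → f₁ * f₂ = 0 → f₁ + f₂ = e → f₁ = 0 ∨ f₂ = 0

/-- The block `B = e O[G]` with block idempotent `e`. -/
def block (e : O[G]) : Submodule O O[G] := LinearMap.range (LinearMap.mulLeft O e)

/-- The opposite block `B° = {x^σ | x ∈ B}`. -/
def oppBlock (e : O[G]) : Submodule O O[G] := (block e).map (wreathRep O G sigma)

/-- The block `B` is real if `B = B°`. -/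
def IsReal (e : O[G]) : Prop := block e = oppBlock e

/-- The relative trace `∑ g a g⁻¹`, with `g` running through representatives of the cosets `gD`.
It does not depend on the representatives if `a` is fixed by conjugation with `D`. -/
def relTrace (D : Subgroup G) (a : O[G]) : O[G] :=
  ∑ᶠ q : G ⧸ D, MonoidAlgebra.of O G q.out * a * MonoidAlgebra.of O G q.out⁻¹

/-- `e` is the relative trace from `D` to `G` of a `D`-fixed element of the group algebra. -/
def IsTraceFrom (e : O[G]) (D : Subgroup G) : Prop :=
  ∃ a : O[G], (∀ d ∈ D, MonoidAlgebra.of O G d * a * MonoidAlgebra.of O G d⁻¹ = a) ∧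
    relTrace D a = e

/-- `D` is a defect group of the block with idempotent `e`: a minimal subgroup such that `e` is a
relative trace from `D` to `G` of a `D`-fixed element of the group algebra. -/
def IsDefectGroup (e : O[G]) (D : Subgroup G) : Prop :=
  Minimal (fun H : Subgroup G => IsTraceFrom e H) D

/-- The image of `e` in the group algebra over the residue field. -/
def residueIdempotent [IsLocalRing O] (e : O[G]) : (IsLocalRing.ResidueField O)[G] :=
  MonoidAlgebra.mapRingHom G (IsLocalRing.residue O) e

/-- The block has defect zero: over the residue field `k`, the block algebra, that is the ring
`ē k[G] = ē k[G] ē` with identity `ē`, is simple. -/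
def HasDefectZero [IsLocalRing O] (e : O[G]) : Prop :=
  ∃ h : IsIdempotentElem (residueIdempotent e), IsSimpleRing h.Corner

lemma wreathRep_inl_mem_block {e : O[G]} (he : IsBlockIdempotent e) (a b : G) {x : O[G]}
    (hx : x ∈ block e) : wreathRep O G (SemidirectProduct.inl (a, b)) x ∈ block e := by
  obtain ⟨y, rfl⟩ := hx
  rw [wreathRep_inl]
  refine ⟨MonoidAlgebra.of O G a * y * MonoidAlgebra.of O G b⁻¹, ?_⟩
  have hc := Subalgebra.mem_center_iff.mp he.central (MonoidAlgebra.of O G a)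
  simp only [LinearMap.mulLeft_apply, ← mul_assoc]
  rw [hc]

lemma inl_mul_sigma (a b : G) :
    (SemidirectProduct.inl (a, b) * sigma : Wreath G) =
      sigma * SemidirectProduct.inl (b, a) := by
  have h1 : sgen ≠ 1 := by decide
  refine SemidirectProduct.ext ?_ ?_
  · change ((a, b) : G × G) * swapHom G 1 1 = 1 * swapHom G sgen (b, a)
    simp [swapHom, h1]
  · change (1 : Sigma2) * sgen = sgen * 1
    simp

/-- `B + B°` as a module for the wreath product. -/
def blockSum {e : O[G]} (he : IsBlockIdempotent e) : Subrepresentation (wreathRep O G) where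
  toSubmodule := block e ⊔ oppBlock e
  apply_mem_toSubmodule w v hv := by
    have key : ∀ u : Sigma2, u = 1 ∨ u = sgen := by decide
    have hsq : (sigma * sigma : Wreath G) = 1 := by
      have h2 : sgen * sgen = 1 := by decide
      rw [sigma, ← map_mul, h2, map_one]
    have hB : ∀ (a b : G) (x : O[G]), x ∈ block e ⊔ oppBlock e →
        wreathRep O G (SemidirectProduct.inl (a, b)) x ∈ block e ⊔ oppBlock e := by
      intro a b x hx
      obtain ⟨y, hy, z, ⟨t, ht, rfl⟩, rfl⟩ := Submodule.mem_sup.mp hx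
      rw [map_add]
      refine Submodule.add_mem_sup (wreathRep_inl_mem_block he a b hy) ?_
      rw [← Module.End.mul_apply, ← map_mul, inl_mul_sigma, map_mul, Module.End.mul_apply]
      exact Submodule.mem_map_of_mem (wreathRep_inl_mem_block he b a ht)
    have hS : ∀ x : O[G], x ∈ block e ⊔ oppBlock e →
        wreathRep O G sigma x ∈ block e ⊔ oppBlock e := by
      intro x hx
      obtain ⟨y, hy, z, ⟨t, ht, rfl⟩, rfl⟩ := Submodule.mem_sup.mp hx
      rw [map_add, add_comm, ← Module.End.mul_apply, ← map_mul, hsq, map_one]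
      exact Submodule.add_mem_sup ht (Submodule.mem_map_of_mem hy)
    obtain ⟨⟨a, b⟩, s⟩ := w
    rw [SemidirectProduct.mk_eq_inl_mul_inr, map_mul, Module.End.mul_apply]
    refine hB a b _ ?_
    rcases key s with rfl | rfl
    · simpa using hv
    · exact hS v hv

/-- If `B` is real, then `B + B°` is just `B`. -/
lemma blockSum_toSubmodule_of_isReal {e : O[G]} (he : IsBlockIdempotent e) (h : IsReal e) :
    (blockSum he).toSubmodule = block e := by
  change block e ⊔ oppBlock e = block e
  rw [← h, sup_idem]

/-- The module afforded by `B + B°`, as a representation of the wreath product. -/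
abbrev blockSumRep {e : O[G]} (he : IsBlockIdempotent e) :
    Representation O (Wreath G) (blockSum he).toSubmodule :=
  (blockSum he).toRepresentation

end Block

end BlockVertex

end

/-!
Let `k` be the residue field of `O` and let `Γ = G ≀ Σ` act on `G` so that `O[G]` is a permutation
module. Put `E = e` if `B` is real and `E = e + e^σ` otherwise, so that `B + B° = E O[G]`.

An endomorphism of `O[G]` that commutes with `Γ` is multiplication by its value at `1`, which is
central and fixed by `σ`. Hence `B + B°` is indecomposable, because `e` is primitive in the centre
(`blockSumRep_isIndecomposable`), and by Higman's criterion (`isRelProjective_iff`) it is relatively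
`H`-projective if and only if multiplication by `E` is a relative trace from `H` to `Γ` of an
`O[H]`-endomorphism of `O[G]` (`isRelProjective_blockSumRep_iff`). Two facts turn this into group
theory. Let `S` be the stabilizer in `Γ` of the pair `(1, c)`.

* If the coefficient of `c` in `E` is nonzero in `k` and `B + B°` is relatively `H`-projective,
  then every `2`-subgroup of `S` is conjugate to a subgroup of `H`: the coefficient is a sum over
  `Γ ⧸ H`, in which only fixed cosets survive modulo `2` (`exists_conj_mem_of_isRelProjective`).
* The matrix unit of `(1, c)` has as its trace from a subgroup `V` of `S` the `|S : V|`-fold of the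
  sum of the conjugates of `c` and `c⁻¹`. If `|S : V|` is odd and this sum is invertible modulo the
  other blocks, then `B + B°` is relatively `V`-projective (`isRelProjective_blockSumRep`).

Completeness of `O` and algebraic closedness of `k` give a central character `φ` of `B`, such that a
central element is invertible in `B` as soon as `φ` does not vanish on it
(`exists_isCentralCharacter`). Since `φ E ≠ 0`, some `c` satisfies the hypotheses of both facts, and
then the Sylow `2`-subgroups of `S` are vertices of `B + B°`. The same two facts for the conjugation
action of `G` on itself show that, after conjugation, the given defect group `D` is a Sylow
`2`-subgroup of the centralizer of `c` (`exists_sylow_centralizer`). It remains to compare the two.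
If `B` is not real, the coefficients of `E` at `c` with `c` conjugate to `c⁻¹` vanish in
characteristic `2`, so that `S` is the diagonal copy of the centralizer. If `B` is real, then `φ` is
fixed by `σ`, and in characteristic `2` it would vanish on the class sum of `c` plus that of `c⁻¹`
if the two classes were different; therefore `c` is conjugate to `c⁻¹`, the diagonal copy of the
centralizer has index `2` in `S`, and a Sylow `2`-subgroup of `S` is an extension of the diagonal
copy of `D` by an element `x σ` (`exists_sylow_stabilizer`).

For the third part, `Σ` is a vertex if and only if `B` is real and `D` is trivial, and `D` is
trivial if and only if `B` has defect zero (`eq_bot_iff_hasDefectZero`). If `D = 1`, the reduction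
of `e` is a trace from the trivial subgroup, and averaging shows that every two-sided ideal of the
reduced block is generated by a central idempotent, so that there are only two of them. Conversely,
a simple reduced block is a matrix algebra over `k`. Its trace map `X ↦ ∑ g X g⁻¹` is not zero,
hence neither is `∑ g c g⁻¹` for some `c`; the centralizer of such a `c` has odd order and
`φ` does not vanish on its class sum.
-/

noncomputable section

namespace BlockVertex

open IsLocalRing

/-! ### Central characters of commutative algebras over a complete local ring -/

theorem isPrecomplete_of_finite {O M : Type*} [CommRing O] [AddCommGroup M] [Module O M]
    [Module.Finite O M] (I : Ideal O) [IsAdicComplete I O] : IsPrecomplete I M := by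
  rw [← AdicCompletion.of_surjective_iff]
  intro y
  obtain ⟨t, rfl⟩ := AdicCompletion.ofTensorProduct_surjective_of_finite I M y
  induction t with
  | zero => exact ⟨0, by simp⟩
  | add a b ha hb =>
    obtain ⟨x, hx⟩ := ha
    obtain ⟨y, hy⟩ := hb
    exact ⟨x + y, by rw [map_add, map_add, hx, hy]⟩
  | tmul r m =>
    obtain ⟨x, rfl⟩ := AdicCompletion.of_surjective I O r
    refine ⟨x • m, ?_⟩
    rw [AdicCompletion.ofTensorProduct_tmul, map_smul]
    ext n
    rfl

instance isAdicComplete_map {O Z : Type*} [CommRing O] [IsLocalRing O] [IsNoetherianRing O]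
    [IsAdicComplete (maximalIdeal O) O] [CommRing Z] [Algebra O Z] [Module.Finite O Z] :
    IsAdicComplete ((maximalIdeal O).map (algebraMap O Z)) Z where
  toIsHausdorff := IsHausdorff.map_algebraMap_iff.mpr inferInstance
  toIsPrecomplete := IsPrecomplete.map_algebraMap_iff.mpr (isPrecomplete_of_finite _)

/-- Idempotents lift along Henselian ideals: an idempotent is a root of `X ^ 2 - X`, whose
derivative `2 * X - 1` squares to `1` modulo the relation. -/
theorem exists_isIdempotentElem_lift {Z : Type*} [CommRing Z] (I : Ideal Z) [HenselianRing Z I]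
    (x : Z) (hx : x * x - x ∈ I) : ∃ f : Z, IsIdempotentElem f ∧ f - x ∈ I := by
  obtain ⟨f, hf, hfx⟩ := HenselianRing.is_henselian (I := I) (Polynomial.X ^ 2 - Polynomial.X)
    (by monicity!) x (by simpa [sq] using hx) (by
      rw [isUnit_iff_exists_inv]
      refine ⟨Ideal.Quotient.mk I (2 * x - 1), ?_⟩
      rw [← map_mul, ← map_one (Ideal.Quotient.mk I), Ideal.Quotient.eq]
      have := I.mul_mem_left 4 hx
      convert this using 1
      simp
      ring)
  refine ⟨f, ?_, hfx⟩
  have : f ^ 2 - f = 0 := by simpa [Polynomial.IsRoot] using hf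
  rw [IsIdempotentElem]
  linear_combination this

theorem exists_isIdempotentElem_separating {R : Type*} [CommRing R] [IsArtinianRing R]
    (m n : Ideal R) [m.IsMaximal] [n.IsPrime] (h : m ≠ n) :
    ∃ f : R, IsIdempotentElem f ∧ f ∈ m ∧ f ∉ n := by
  obtain ⟨x, hxm, hxn⟩ : ∃ x ∈ m, x ∉ n := by
    by_contra! H
    exact h (‹m.IsMaximal›.eq_of_le (Ideal.IsPrime.ne_top ‹_›) H)
  obtain ⟨k, y, hy⟩ := IsArtinian.exists_pow_succ_smul_dvd x (1 : R)
  simp only [smul_eq_mul, mul_one, Nat.succ_eq_add_one] at hy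
  -- The descending chain of powers of `x` stops, and a power of `x * y` is an idempotent that
  -- generates the same ideal as `x ^ (k + 1)`.
  have key : ∀ j, x ^ (k + 1) * (x * y) ^ j = x ^ (k + 1) := by
    intro j
    induction j with
    | zero => simp
    | succ j ih =>
      calc x ^ (k + 1) * (x * y) ^ (j + 1) = x ^ (k + 1) * (x * y) ^ j * (x * y) := by ring
        _ = x * (x ^ (k + 1) * y) := by rw [ih]; ring
        _ = x ^ (k + 1) := by rw [hy]; ring
  have hx : x ^ (k + 1) * (x * y) ^ (k + 1) = x ^ (k + 1) := key _
  refine ⟨(x * y) ^ (k + 1), ?_, ?_, fun hn => hxn ?_⟩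
  · change (x * y) ^ (k + 1) * (x * y) ^ (k + 1) = (x * y) ^ (k + 1)
    calc (x * y) ^ (k + 1) * (x * y) ^ (k + 1)
        = y ^ (k + 1) * (x ^ (k + 1) * (x * y) ^ (k + 1)) := by ring
      _ = (x * y) ^ (k + 1) := by rw [hx]; ring
  · exact m.pow_mem_of_mem (m.mul_mem_right y hxm) _ k.succ_pos
  · refine (‹n.IsPrime›).mem_of_pow_mem (k + 1) ?_
    rw [← hx]
    exact n.mul_mem_left _ hn

/-- A primitive idempotent `e` of a finite commutative algebra over a complete local ring with
algebraically closed residue field lies outside exactly one maximal ideal. The quotient by this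
ideal is the residue field, and elements outside of it are invertible in the direct factor of `e`.
-/
theorem exists_algHom_residueField {O Z : Type*} [CommRing O] [IsLocalRing O]
    [IsNoetherianRing O] [IsAdicComplete (maximalIdeal O) O] [IsAlgClosed (ResidueField O)]
    [CommRing Z] [Algebra O Z] [Module.Finite O Z] (e : Z) (he : IsIdempotentElem e)
    (hne : e ≠ 0) (hprim : ∀ f : Z, IsIdempotentElem f → e * f = 0 ∨ e * (1 - f) = 0) :
    ∃ φ : Z →ₐ[O] ResidueField O, φ e = 1 ∧ ∀ z, φ z ≠ 0 → ∃ b, z * b = e := by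
  have hmax : ∀ n : Ideal Z, n.IsMaximal → (maximalIdeal O).map (algebraMap O Z) ≤ n := by
    intro n hn
    rw [Ideal.map_le_iff_le_comap]
    have := Ideal.isMaximal_comap_of_isIntegral_of_isMaximal (R := O) n
    exact (eq_maximalIdeal this).ge
  obtain ⟨n, hn, hen⟩ := Ideal.exists_le_maximal (Ideal.span {1 - e}) (by
    rw [Ne, Ideal.span_singleton_eq_top]
    intro hu
    refine hne ?_
    have : e * (1 - e) = 0 := by rw [mul_sub, he.eq]; simp
    exact (hu.mul_left_eq_zero).mp this)
  have hen1 : 1 - e ∈ n := hen (Ideal.mem_span_singleton_self _)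
  -- Idempotents separate two maximal ideals modulo the maximal ideal of `O`, and they lift.
  have huniq : ∀ n' : Ideal Z, n'.IsMaximal → 1 - e ∈ n' → n' = n := by
    intro n' hn' hen'
    by_contra hne'
    set I := (maximalIdeal O).map (algebraMap O Z)
    have hker : RingHom.ker (Ideal.Quotient.mk I) = I := Ideal.mk_ker
    have : (n.map (Ideal.Quotient.mk I)).IsMaximal :=
      Ideal.IsMaximal.map_of_surjective_of_ker_le Ideal.Quotient.mk_surjective
        (by rw [hker]; exact hmax n hn)
    have : (n'.map (Ideal.Quotient.mk I)).IsMaximal :=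
      Ideal.IsMaximal.map_of_surjective_of_ker_le Ideal.Quotient.mk_surjective
        (by rw [hker]; exact hmax n' hn')
    have hcm : ∀ p : Ideal Z, p.IsMaximal →
        (p.map (Ideal.Quotient.mk I)).comap (Ideal.Quotient.mk I) = p := by
      intro p hp
      rw [Ideal.comap_map_of_surjective _ Ideal.Quotient.mk_surjective, sup_eq_left]
      rw [← RingHom.ker_eq_comap_bot, hker]
      exact hmax p hp
    have : IsArtinianRing (Z ⧸ I) := by
      let _ : Field (O ⧸ maximalIdeal O) := Ideal.Quotient.field _
      have : Module.Finite (O ⧸ maximalIdeal O) (Z ⧸ I) := inferInstance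
      exact IsArtinianRing.of_finite (O ⧸ maximalIdeal O) (Z ⧸ I)
    obtain ⟨f, hf, hfn, hfn'⟩ := exists_isIdempotentElem_separating
      (n.map (Ideal.Quotient.mk I)) (n'.map (Ideal.Quotient.mk I)) (by
        intro h
        exact hne' (by rw [← hcm n' hn', ← h, hcm n hn]))
    obtain ⟨x, rfl⟩ := Ideal.Quotient.mk_surjective f
    rw [← Ideal.mem_comap, hcm _ ‹_›] at hfn hfn'
    obtain ⟨g, hg, hgx⟩ := exists_isIdempotentElem_lift I x (by
      rw [← Ideal.Quotient.eq, map_mul]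
      exact hf)
    have hgn : g ∈ n := by simpa using n.add_mem (hmax n hn hgx) hfn
    have hgn' : g ∉ n' := fun h => hfn' (by simpa using n'.sub_mem h (hmax n' hn' hgx))
    rcases hprim g hg with h | h
    · refine hgn' ?_
      have : (1 - e) * g ∈ n' := n'.mul_mem_right _ hen'
      rwa [sub_mul, h, one_mul, sub_zero] at this
    · refine hn.ne_top ((Ideal.eq_top_iff_one n).mpr ?_)
      have h1 : 1 - e + e * g ∈ n := n.add_mem hen1 (n.mul_mem_left _ hgn)
      have : e * g = e := by linear_combination -h
      rwa [this, sub_add_cancel] at h1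
  let _ : Field (Z ⧸ n) := Ideal.Quotient.field n
  let j : ResidueField O →+* Z ⧸ n := Ideal.Quotient.lift _ (algebraMap O (Z ⧸ n)) (by
    intro a ha
    exact Ideal.Quotient.eq_zero_iff_mem.mpr (hmax n hn (Ideal.mem_map_of_mem _ ha)))
  let _ : Algebra (ResidueField O) (Z ⧸ n) := j.toAlgebra
  have : IsScalarTower O (ResidueField O) (Z ⧸ n) := .of_algebraMap_eq fun _ => rfl
  have : Module.Finite (ResidueField O) (Z ⧸ n) :=
    Module.Finite.of_restrictScalars_finite O _ _
  have hbij : Function.Bijective (algebraMap (ResidueField O) (Z ⧸ n)) :=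
    IsAlgClosed.algebraMap_bijective_of_isIntegral
  let ψ : (Z ⧸ n) ≃ₐ[O] ResidueField O :=
    (AlgEquiv.ofBijective (IsScalarTower.toAlgHom O (ResidueField O) (Z ⧸ n)) hbij).symm
  refine ⟨ψ.toAlgHom.comp (Ideal.Quotient.mkₐ O n), ?_, ?_⟩
  · have : Ideal.Quotient.mk n e = 1 := by
      rw [← map_one (Ideal.Quotient.mk n), eq_comm, Ideal.Quotient.eq]
      exact hen1
    change ψ (Ideal.Quotient.mk n e) = 1
    rw [this, map_one]
  · intro z hz
    have hzn : z ∉ n := by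
      intro h
      refine hz ?_
      change ψ (Ideal.Quotient.mk n z) = 0
      rw [Ideal.Quotient.eq_zero_iff_mem.mpr h, map_zero]
    have htop : Ideal.span {1 - e, z} = ⊤ := by
      by_contra h
      obtain ⟨p, hp, hle⟩ := Ideal.exists_le_maximal _ h
      have := huniq p hp (hle (Ideal.subset_span (by simp)))
      exact hzn (this ▸ hle (Ideal.subset_span (by simp)))
    obtain ⟨a, b, hab⟩ := Ideal.mem_span_pair.mp ((Ideal.eq_top_iff_one _).mp htop)
    exact ⟨b * e, by linear_combination e * hab + a * he.eq⟩

/-! ### Fixed points of `2`-groups on orbits -/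

/-- In characteristic `p`, the sum over a `P`-set of a function that is constant on orbits only
depends on the fixed points of the `p`-group `P`. -/
theorem exists_fixed_of_sum_ne_zero {P α k : Type*} [Group P] [MulAction P α] [Fintype α]
    [Field k] {p : ℕ} [Fact p.Prime] [CharP k p] (hP : IsPGroup p P) [Finite P] (f : α → k)
    (hf : ∀ (x : P) (a : α), f (x • a) = f a) (hs : ∑ a, f a ≠ 0) :
    ∃ a, (∀ x : P, x • a = a) ∧ f a ≠ 0 := by
  classical
  by_contra! H
  refine hs ?_
  -- Split the sum by the values of `f`; each level set is stable under `P`.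
  have := Finset.sum_comp (s := Finset.univ) (fun v : k => v) f
  rw [this]
  refine Finset.sum_eq_zero fun v _ => ?_
  by_cases hv : v = 0
  · rw [hv, smul_zero]
  let S : SubMulAction P α := ⟨{a | f a = v}, fun x a ha => by
    change f (x • a) = v
    rw [hf]; exact ha⟩
  have hcard := hP.card_modEq_card_fixedPoints S
  have hempty : IsEmpty (MulAction.fixedPoints P S) := by
    refine ⟨fun a => hv ?_⟩
    rw [← show f a.1.1 = v from a.1.2]
    exact H _ fun x => congrArg Subtype.val (a.2 x)
  rw [Nat.card_of_isEmpty (α := MulAction.fixedPoints P S), Nat.modEq_zero_iff_dvd] at hcard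
  have hS : Nat.card S = (Finset.univ.filter fun a => f a = v).card := by
    rw [← Fintype.card_subtype, ← Nat.card_eq_fintype_card]
    rfl
  rw [← hS, ← Nat.cast_smul_eq_nsmul k, (CharP.cast_eq_zero_iff k p _).mpr hcard, zero_smul]

/-- If a sum over `Γ ⧸ H` of a `P`-invariant function does not vanish in characteristic `p`, then
the `p`-group `P` fixes a coset, which means that a conjugate of `P` lies in `H`. -/
theorem exists_conj_mem_of_sum_quotient_ne_zero {Γ k : Type*} [Group Γ] [Finite Γ] [Field k]
    {p : ℕ} [Fact p.Prime] [CharP k p] (H P : Subgroup Γ) [Fintype (Γ ⧸ H)] (hP : IsPGroup p P)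
    (F : Γ → k) (hH : ∀ w, ∀ h ∈ H, F (w * h) = F w) (hPF : ∀ w, ∀ x ∈ P, F (x * w) = F w)
    (hs : ∑ q : Γ ⧸ H, F q.out ≠ 0) : ∃ w, ∀ x ∈ P, w⁻¹ * x * w ∈ H := by
  have hmk : ∀ w : Γ, F (w : Γ ⧸ H).out = F w := by
    intro w
    obtain ⟨h, hh⟩ := QuotientGroup.mk_out_eq_mul H w
    rw [hh, hH _ _ h.2]
  obtain ⟨q, hq, -⟩ := exists_fixed_of_sum_ne_zero (α := Γ ⧸ H) hP (fun q => F q.out) (by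
    intro x q
    induction q using QuotientGroup.induction_on with
    | H w =>
      change F ((x.1 * w : Γ) : Γ ⧸ H).out = _
      rw [hmk, hmk, hPF _ _ x.2]) hs
  induction q using QuotientGroup.induction_on with
  | H w =>
    refine ⟨w, fun x hx => ?_⟩
    have h1 : ((w : Γ) : Γ ⧸ H) = ((x * w : Γ) : Γ ⧸ H) := (hq ⟨x, hx⟩).symm
    rw [QuotientGroup.eq] at h1
    rwa [mul_assoc]

theorem card_quotient_smul_eq {Γ Y : Type*} [Group Γ] [MulAction Γ Y] (V : Subgroup Γ)
    (y₀ y : Y) (hV : V ≤ MulAction.stabilizer Γ y₀) (hy : y ∈ MulAction.orbit Γ y₀) :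
    Nat.card {q : Γ ⧸ V // q.out • y₀ = y} = V.relIndex (MulAction.stabilizer Γ y₀) := by
  obtain ⟨w, rfl⟩ := hy
  let ε := Subgroup.quotientEquivProdOfLE hV
  have h1 : ∀ q : Γ ⧸ V, q.out • y₀ = w • y₀ ↔ (ε q).1 = (w : Γ ⧸ MulAction.stabilizer Γ y₀) := by
    intro q
    have : (ε q).1 = (q.out : Γ ⧸ MulAction.stabilizer Γ y₀) := by
      conv_lhs => rw [← QuotientGroup.out_eq' q]
      rfl
    rw [this, QuotientGroup.eq, MulAction.mem_stabilizer_iff, mul_smul, eq_comm (a := q.out • y₀),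
      inv_smul_eq_iff]
  rw [Subgroup.relIndex, Subgroup.index]
  refine Nat.card_congr ((ε.subtypeEquiv (q := fun x => x.1 = (w : Γ ⧸ _)) h1).trans ?_)
  exact {
    toFun := fun x => x.1.2
    invFun := fun x => ⟨(w, x), rfl⟩
    left_inv := by rintro ⟨⟨a, b⟩, h⟩; exact Subtype.ext (Prod.ext h.symm rfl)
    right_inv := fun x => rfl }

/-! ### Higman's criterion -/

section Higman

variable {A Γ M : Type*} [CommRing A] [Group Γ] [AddCommGroup M] [Module A M]

theorem sum_quotient_mul_left {N : Type*} [AddCommMonoid N] (H : Subgroup Γ) [Fintype (Γ ⧸ H)]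
    (F : Γ → N) (hF : ∀ w, ∀ h ∈ H, F (w * h) = F w) (g : Γ) :
    ∑ q : Γ ⧸ H, F (g * q.out) = ∑ q : Γ ⧸ H, F q.out := by
  have hmk : ∀ w : Γ, F (w : Γ ⧸ H).out = F w := by
    intro w
    obtain ⟨h, hh⟩ := QuotientGroup.mk_out_eq_mul H w
    rw [hh, hF _ _ h.2]
  refine Fintype.sum_equiv (MulAction.toPerm g) _ _ fun q => ?_
  induction q using QuotientGroup.induction_on with
  | H w =>
    change _ = F ((g * w : Γ) : Γ ⧸ H).out
    rw [hmk]
    obtain ⟨h, hh⟩ := QuotientGroup.mk_out_eq_mul H w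
    rw [hh, ← mul_assoc, hF _ _ h.2]

/-- The map sending `m` to the class of `w ⊗ m` in the module induced from the subgroup `H`. -/
def indMk (ρ : Representation A Γ M) (H : Subgroup Γ) (w : Γ) :
    M →ₗ[A] Representation.IndV H.subtype (ρ.comp H.subtype) :=
  Representation.IndV.mk H.subtype (ρ.comp H.subtype) w

theorem ind_indMk (ρ : Representation A Γ M) (H : Subgroup Γ) (g w : Γ) (a : M) :
    Representation.ind H.subtype (ρ.comp H.subtype) g (indMk ρ H w a) =
      indMk ρ H (w * g⁻¹) a :=
  Representation.ind_mk _ _ _ _ _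

theorem indMk_mul (ρ : Representation A Γ M) (H : Subgroup Γ) {h : Γ} (hh : h ∈ H) (w : Γ) (a : M) :
    indMk ρ H (h * w) (ρ h a) = indMk ρ H w a := by
  have := Representation.Coinvariants.mk_self_apply
    (Representation.tprod ((Representation.leftRegular A Γ).comp H.subtype) (ρ.comp H.subtype))
    ⟨h, hh⟩ (TensorProduct.tmul A (MonoidAlgebra.single w 1) a)
  simpa [indMk] using this

theorem indMk_hom_ext {N : Type*} [AddCommGroup N] [Module A N] (ρ : Representation A Γ M)
    (H : Subgroup Γ) (f g : Representation.IndV H.subtype (ρ.comp H.subtype) →ₗ[A] N)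
    (h : ∀ w a, f (indMk ρ H w a) = g (indMk ρ H w a)) (x) : f x = g x := by
  suffices f = g from congrArg (fun f : _ →ₗ[A] _ => f x) this
  exact Representation.IndV.hom_ext _ _ fun w => LinearMap.ext fun a => h w a

/-- The map out of an induced module that is given by a compatible family of maps. -/
def indLift {N : Type*} [AddCommGroup N] [Module A N] (ρ : Representation A Γ M) (H : Subgroup Γ)
    (f : Γ → M →ₗ[A] N) (hf : ∀ h ∈ H, ∀ w a, f (h * w) (ρ h a) = f w a) :
    Representation.IndV H.subtype (ρ.comp H.subtype) →ₗ[A] N :=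
  Representation.Coinvariants.lift _
    (TensorProduct.lift ((Finsupp.lift _ _ _ f) ∘ₗ
      (MonoidAlgebra.coeffLinearEquiv A).toLinearMap)) (by
    intro h
    ext w a
    simpa using hf h h.2 w a)

theorem indLift_mk {N : Type*} [AddCommGroup N] [Module A N] (ρ : Representation A Γ M)
    (H : Subgroup Γ) (f : Γ → M →ₗ[A] N) (hf : ∀ h ∈ H, ∀ w a, f (h * w) (ρ h a) = f w a)
    (w : Γ) (a : M) :
    indLift ρ H f hf (indMk ρ H w a) = f w a := by
  simp [indLift, indMk]

/-- Higman's criterion: relative projectivity means that the identity is a relative trace of an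
endomorphism that commutes with `H`. -/
theorem isRelProjective_iff (ρ : Representation A Γ M) (H : Subgroup Γ)
    [Fintype (Γ ⧸ H)] :
    IsRelProjective ρ H ↔ ∃ θ : M →ₗ[A] M, (∀ h ∈ H, ∀ m, θ (ρ h m) = ρ h (θ m)) ∧
      ∀ m, ∑ q : Γ ⧸ H, ρ q.out (θ (ρ q.out⁻¹ m)) = m := by
  classical
  have hρ : ∀ v w m, ρ (v * w) m = ρ v (ρ w m) := fun v w m => by rw [map_mul]; rfl
  constructor
  · rintro ⟨i, p, hpi⟩
    -- The map `c` projects the induced module onto the summand `1 ⊗ M`; the identity of the induced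
    -- module is its trace, and transporting `c` along `i` and `p` gives the endomorphism of `M`.
    let c := indLift ρ H (fun w => if w ∈ H then ρ w⁻¹ else 0) (by
      intro h hh w a
      by_cases hw : w ∈ H
      · simp only [hw, H.mul_mem hh hw, if_true]
        rw [← hρ]
        simp
      · simp [hw, H.mul_mem_cancel_left hh])
    have hcmk : ∀ w a, c (indMk ρ H w a) = if w ∈ H then ρ w⁻¹ a else 0 := by
      intro w a
      refine (indLift_mk ρ H _ _ w a).trans ?_
      split_ifs <;> simp
    have hc : ∀ h ∈ H, ∀ x, c (Representation.ind H.subtype (ρ.comp H.subtype) h x) =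
        ρ h (c x) := by
      intro h hh
      refine indMk_hom_ext ρ H
        (c ∘ₗ (Representation.ind H.subtype (ρ.comp H.subtype) h)) (ρ h ∘ₗ c) ?_
      intro w a
      rw [LinearMap.comp_apply, LinearMap.comp_apply, ind_indMk, hcmk, hcmk,
        H.mul_mem_cancel_right (H.inv_mem hh)]
      split_ifs
      · rw [← hρ]; simp
      · simp
    have hmk1 : ∀ h ∈ H, ∀ a, indMk ρ H 1 (ρ h a) = indMk ρ H h⁻¹ a := by
      intro h hh a
      have := indMk_mul ρ H hh h⁻¹ a
      rwa [mul_inv_cancel] at this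
    have hsum : ∀ x, ∑ q : Γ ⧸ H, Representation.ind H.subtype (ρ.comp H.subtype) q.out
        (indMk ρ H 1 (c (Representation.ind H.subtype (ρ.comp H.subtype) q.out⁻¹ x))) = x := by
      intro x
      have := indMk_hom_ext ρ H (∑ q : Γ ⧸ H,
        Representation.ind H.subtype (ρ.comp H.subtype) q.out ∘ₗ indMk ρ H 1 ∘ₗ c ∘ₗ
        Representation.ind H.subtype (ρ.comp H.subtype) q.out⁻¹) LinearMap.id ?_ x
      · simpa only [LinearMap.sum_apply, LinearMap.comp_apply, LinearMap.id_apply] using this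
      intro w a
      simp only [LinearMap.sum_apply, LinearMap.comp_apply, ind_indMk, hcmk, LinearMap.id_apply]
      rw [Finset.sum_eq_single ((w⁻¹ : Γ) : Γ ⧸ H)]
      · obtain ⟨h, hh⟩ := QuotientGroup.mk_out_eq_mul H w⁻¹
        have : w * ((w⁻¹ : Γ) : Γ ⧸ H).out⁻¹⁻¹ = h := by rw [hh]; group
        rw [this, if_pos h.2, hh, show 1 * (w⁻¹ * (h : Γ))⁻¹ = (h : Γ)⁻¹ * w by group,
          indMk_mul ρ H (H.inv_mem h.2)]
      · intro q _ hq
        rw [if_neg, map_zero]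
        intro hmem
        refine hq ?_
        rw [← QuotientGroup.out_eq' q, eq_comm, QuotientGroup.eq]
        simpa using hmem
      · simp
    refine ⟨p.toLinearMap ∘ₗ indMk ρ H 1 ∘ₗ c ∘ₗ i.toLinearMap, ?_, ?_⟩
    · intro h hh m
      have h1 : i (ρ h m) = _ := i.isIntertwining _ _ h m
      have h2 : ∀ x, p (_) = _ := p.isIntertwining _ _ h
      simp only [LinearMap.comp_apply, Representation.IntertwiningMap.coe_toLinearMap, h1]
      rw [hc h hh, hmk1 h hh, ← h2, ind_indMk, one_mul]
    · intro m
      have h1 : ∀ g, i (ρ g m) = _ := fun g => i.isIntertwining _ _ g m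
      have h2 : ∀ g x, p (_) = _ := p.isIntertwining _ _
      simp only [LinearMap.comp_apply, Representation.IntertwiningMap.coe_toLinearMap, h1]
      simp only [← h2]
      rw [← map_sum, hsum]
      exact congrArg (fun f : _ →ₗ[A] _ => f m) hpi
  -- The inclusion is `m ↦ ∑ w ⊗ θ (w⁻¹ m)`, and the projection is the multiplication map.
  · rintro ⟨θ, hθ, hid⟩
    have hF : ∀ m w, ∀ h ∈ H, indMk ρ H (w * h)⁻¹ (θ (ρ (w * h)⁻¹ m)) =
        indMk ρ H w⁻¹ (θ (ρ w⁻¹ m)) := by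
      intro m w h hh
      rw [mul_inv_rev, hρ, hθ _ (H.inv_mem hh), indMk_mul ρ H (H.inv_mem hh)]
    have hlift : ∀ h ∈ H, ∀ w a, ρ (h * w)⁻¹ (ρ h a) = ρ w⁻¹ a := by
      intro h hh w a
      rw [← hρ]; simp
    refine ⟨⟨∑ q : Γ ⧸ H, indMk ρ H q.out⁻¹ ∘ₗ θ ∘ₗ ρ q.out⁻¹, fun g => ?_⟩,
      ⟨indLift ρ H (fun w => ρ w⁻¹) hlift, fun g => ?_⟩, ?_⟩
    · ext m
      simp only [LinearMap.sum_apply, LinearMap.comp_apply, map_sum, ind_indMk]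
      have := sum_quotient_mul_left H (fun w => indMk ρ H (w⁻¹ * g⁻¹) (θ (ρ w⁻¹ m)))
        (fun w h hh => by rw [← ind_indMk, hF m w h hh, ind_indMk]) g⁻¹
      rw [← this]
      refine Finset.sum_congr rfl fun q _ => ?_
      rw [← hρ, mul_inv_rev, inv_inv, mul_assoc, mul_inv_cancel, mul_one]
    · refine LinearMap.ext (indMk_hom_ext ρ H _ _ fun w a => ?_)
      rw [LinearMap.comp_apply, LinearMap.comp_apply, ind_indMk, indLift_mk, indLift_mk, ← hρ]
      simp
    · ext m
      simp only [LinearMap.sum_apply, LinearMap.comp_apply, map_sum, indLift_mk]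
      simpa using hid m

end Higman

/-! ### The group algebra as a module for the wreath product -/

section GroupAlgebra

variable {O G : Type*} [CommRing O] [Group G]

/-- The action of the wreath product on `G` through `wreathPerm`. -/
instance wreathMulAction : MulAction (Wreath G) G where
  smul w x := wreathPerm w x
  one_smul x := by
    change wreathPerm 1 x = x
    simp [wreathPerm]
  mul_smul v w x := congrFun (wreathPerm_mul v w) x

theorem wreath_smul_def (w : Wreath G) (x : G) : w • x = wreathPerm w x := rfl

theorem inl_smul (a b x : G) : (SemidirectProduct.inl (a, b) : Wreath G) • x = a * x * b⁻¹ := by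
  simp [wreath_smul_def, wreathPerm]

theorem diag_smul (g x : G) : (diag g : Wreath G) • x = g * x * g⁻¹ := inl_smul g g x

theorem sigma_smul (x : G) : (sigma : Wreath G) • x = x⁻¹ := by
  have h1 : sgen ≠ 1 := by decide
  simp [wreath_smul_def, wreathPerm, sigma, h1]

theorem wreathRep_single (w : Wreath G) (g : G) (c : O) :
    wreathRep O G w (MonoidAlgebra.single g c) = MonoidAlgebra.single (w • g) c := by
  change MonoidAlgebra.mapDomainLinearMap O O (wreathPerm w) (MonoidAlgebra.single g c) = _
  simp [wreath_smul_def]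

theorem coeff_wreathRep (w : Wreath G) (x : O[G]) (g : G) :
    (wreathRep O G w x).coeff g = x.coeff (w⁻¹ • g) := by
  classical
  induction x using MonoidAlgebra.induction_linear with
  | zero => simp
  | add x y hx hy => simp [hx, hy]
  | single h a =>
    rw [wreathRep_single]
    simp only [MonoidAlgebra.coeff_single, Finsupp.single_apply, eq_inv_smul_iff]

/-- An element of the wreath product is a pair times a power of `σ`. -/
theorem wreath_cases (w : Wreath G) : (∃ a b : G, w = SemidirectProduct.inl (a, b)) ∨
    ∃ a b : G, w = SemidirectProduct.inl (a, b) * sigma := by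
  have key : ∀ u : Sigma2, u = 1 ∨ u = sgen := by decide
  obtain ⟨⟨a, b⟩, s⟩ := w
  rw [SemidirectProduct.mk_eq_inl_mul_inr]
  rcases key s with rfl | rfl
  · exact .inl ⟨a, b, by simp⟩
  · exact .inr ⟨a, b, rfl⟩

theorem mem_center_iff_coeff {x : O[G]} :
    x ∈ Subalgebra.center O O[G] ↔ ∀ g h, x.coeff (g * h * g⁻¹) = x.coeff h := by
  rw [Subalgebra.mem_center_iff]
  constructor
  · intro hx g h
    have := congrArg (fun y : O[G] => y.coeff (g * h)) (hx (MonoidAlgebra.single g 1))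
    simpa [MonoidAlgebra.coeff_single_mul_apply, MonoidAlgebra.coeff_mul_single_apply]
      using this.symm
  · intro hx y
    induction y using MonoidAlgebra.induction_linear with
    | zero => simp
    | add x y hx hy => rw [add_mul, mul_add, hx, hy]
    | single g a =>
      ext h
      have := hx g (g⁻¹ * h)
      simp [MonoidAlgebra.coeff_single_mul_apply, MonoidAlgebra.coeff_mul_single_apply] at this ⊢
      rw [← this, mul_comm]

theorem sigma_mul (x y : O[G]) : wreathRep O G sigma (x * y) =
    wreathRep O G sigma y * wreathRep O G sigma x := by
  induction x using MonoidAlgebra.induction_linear with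
  | zero => simp
  | add x₁ x₂ h₁ h₂ => rw [add_mul, map_add, map_add, mul_add, h₁, h₂]
  | single g a =>
    induction y using MonoidAlgebra.induction_linear with
    | zero => simp
    | add x₁ x₂ h₁ h₂ => rw [mul_add, map_add, map_add, add_mul, h₁, h₂]
    | single h b =>
      simp [wreathRep_single, sigma_smul, mul_comm]

theorem sigma_sigma (x : O[G]) : wreathRep O G sigma (wreathRep O G sigma x) = x := by
  ext g
  have : (sigma⁻¹ : Wreath G) = sigma := by
    have h2 : sgen⁻¹ = sgen := by decide
    rw [sigma, ← map_inv, h2]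
  rw [coeff_wreathRep, coeff_wreathRep, this, sigma_smul, sigma_smul, inv_inv]

theorem coeff_sigma (x : O[G]) (g : G) : (wreathRep O G sigma x).coeff g = x.coeff g⁻¹ := by
  have : (sigma⁻¹ : Wreath G) = sigma := by
    have h2 : sgen⁻¹ = sgen := by decide
    rw [sigma, ← map_inv, h2]
  rw [coeff_wreathRep, this, sigma_smul]

theorem sigma_mem_center {x : O[G]} (hx : x ∈ Subalgebra.center O O[G]) :
    wreathRep O G sigma x ∈ Subalgebra.center O O[G] := by
  rw [mem_center_iff_coeff] at hx ⊢
  intro g h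
  rw [coeff_sigma, coeff_sigma, ← hx g h⁻¹]
  congr 1
  group

theorem wreathRep_mul_of_mem_center {z : O[G]} (hz : z ∈ Subalgebra.center O O[G])
    (hs : wreathRep O G sigma z = z) (w : Wreath G) (x : O[G]) :
    wreathRep O G w (z * x) = z * wreathRep O G w x := by
  have hc := Subalgebra.mem_center_iff.mp hz
  have hinl : ∀ a b x, wreathRep O G (SemidirectProduct.inl (a, b)) (z * x) =
      z * wreathRep O G (SemidirectProduct.inl (a, b)) x := by
    intro a b x
    rw [wreathRep_inl, wreathRep_inl, ← mul_assoc, hc, mul_assoc, mul_assoc, mul_assoc]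
  rcases wreath_cases w with ⟨a, b, rfl⟩ | ⟨a, b, rfl⟩
  · exact hinl a b x
  · rw [map_mul (wreathRep O G), Module.End.mul_apply, Module.End.mul_apply, sigma_mul, hs, hc,
      hinl]

/-- An endomorphism of `O[G]` that commutes with the wreath product is multiplication by a central
element that is fixed by `σ`: it commutes with right multiplications, and `diag g` and `σ` fix `1`.
-/
theorem eq_mul_of_equivariant (T : O[G] →ₗ[O] O[G])
    (hT : ∀ w x, T (wreathRep O G w x) = wreathRep O G w (T x)) :
    T 1 ∈ Subalgebra.center O O[G] ∧ wreathRep O G sigma (T 1) = T 1 ∧ ∀ x, T x = T 1 * x := by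
  have h1 : ∀ w : Wreath G, w • (1 : G) = 1 → wreathRep O G w (T 1) = T 1 := by
    intro w hw
    rw [← hT, MonoidAlgebra.one_def, wreathRep_single, hw]
  refine ⟨?_, ?_, ?_⟩
  · rw [mem_center_iff_coeff]
    intro g h
    conv_lhs => rw [← h1 (diag g) (by simp [diag_smul]), coeff_wreathRep, ← map_inv, diag_smul]
    congr 1
    group
  · exact h1 _ (by simp [sigma_smul])
  · intro x
    induction x using MonoidAlgebra.induction_linear with
    | zero => simp
    | add x y hx hy => rw [map_add, mul_add, hx, hy]
    | single g a =>
      have := hT (SemidirectProduct.inl (1, g⁻¹)) 1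
      rw [wreathRep_inl, wreathRep_inl] at this
      have h2 : (MonoidAlgebra.single g a : O[G]) = a • MonoidAlgebra.single g 1 := by simp
      rw [h2, map_smul, mul_smul_comm]
      simpa [← MonoidAlgebra.one_def] using congrArg (a • ·) this

end GroupAlgebra

/-! ### The module `B + B°` -/

section Hull

variable {O G : Type*} [CommRing O] [Group G]

theorem mem_block_iff {e x : O[G]} (he : IsIdempotentElem e) : x ∈ block e ↔ e * x = x := by
  constructor
  · rintro ⟨y, rfl⟩
    rw [LinearMap.mulLeft_apply, ← mul_assoc, he.eq]
  · intro h
    exact ⟨x, h⟩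

theorem IsBlockIdempotent.mul_eq_zero_or_eq {e t : O[G]} (he : IsBlockIdempotent e)
    (ht : t ∈ Subalgebra.center O O[G]) (hti : IsIdempotentElem t) : e * t = 0 ∨ e * t = e := by
  have hc : Commute e t := (Subalgebra.mem_center_iff.mp ht e)
  have h1 : e * t * (e * t) = e * t := by
    rw [hc.symm.mul_mul_mul_comm, he.idem.eq, hti.eq]
  have h2 : e * (e * t) = e * t := by rw [← mul_assoc, he.idem.eq]
  have h3 : e * t * e = e * t := by rw [mul_assoc, ← hc.eq, h2]
  rcases he.primitive (e * t) (mul_mem he.central ht) (e - e * t)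
    (sub_mem he.central (mul_mem he.central ht)) h1
    (by rw [IsIdempotentElem, sub_mul, mul_sub, mul_sub, he.idem.eq, h1, h2, h3]; simp)
    (by rw [mul_sub, h1, h3, sub_self]) (by abel) with h | h
  · exact .inl h
  · exact .inr (sub_eq_zero.mp h).symm

theorem sigma_isIdempotentElem {e : O[G]} (he : IsIdempotentElem e) :
    IsIdempotentElem (wreathRep O G sigma e) := by
  rw [IsIdempotentElem, ← sigma_mul, he.eq]

theorem IsBlockIdempotent.sigma {e : O[G]} (he : IsBlockIdempotent e) :
    IsBlockIdempotent (wreathRep O G sigma e) where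
  central := sigma_mem_center he.central
  idem := sigma_isIdempotentElem he.idem
  ne_zero h := he.ne_zero (by rw [← sigma_sigma e, h, map_zero])
  primitive f₁ h₁ f₂ h₂ i₁ i₂ h0 hs := by
    rcases he.primitive _ (sigma_mem_center h₁) _ (sigma_mem_center h₂)
      (sigma_isIdempotentElem i₁) (sigma_isIdempotentElem i₂)
      (by rw [← sigma_mul, ← Subalgebra.mem_center_iff.mp h₂ f₁, h0, map_zero])
      (by rw [← map_add, hs, sigma_sigma]) with h | h
    · exact .inl (by rw [← sigma_sigma f₁, h, map_zero])
    · exact .inr (by rw [← sigma_sigma f₂, h, map_zero])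

theorem oppBlock_eq {e : O[G]} (he : IsBlockIdempotent e) :
    oppBlock e = block (wreathRep O G sigma e) := by
  ext x
  rw [mem_block_iff he.sigma.idem]
  constructor
  · rintro ⟨y, hy, rfl⟩
    rw [← Subalgebra.mem_center_iff.mp he.sigma.central, ← sigma_mul, (mem_block_iff he.idem).mp hy]
  · intro h
    refine ⟨wreathRep O G sigma x, (mem_block_iff he.idem).mpr ?_, sigma_sigma x⟩
    conv_rhs => rw [← h]
    rw [sigma_mul, sigma_sigma, Subalgebra.mem_center_iff.mp he.central]

theorem isReal_iff {e : O[G]} (he : IsBlockIdempotent e) :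
    IsReal e ↔ wreathRep O G sigma e = e := by
  rw [IsReal, oppBlock_eq he]
  constructor
  · intro h
    have h1 : e ∈ block (wreathRep O G sigma e) := h ▸ (mem_block_iff he.idem).mpr he.idem
    have h2 : wreathRep O G sigma e ∈ block e := h ▸ (mem_block_iff he.sigma.idem).mpr he.sigma.idem
    rw [mem_block_iff he.sigma.idem] at h1
    rw [mem_block_iff he.idem] at h2
    rw [← h2, Subalgebra.mem_center_iff.mp he.sigma.central, h1]
  · intro h
    rw [h]

theorem mul_sigma_eq_zero {e : O[G]} (he : IsBlockIdempotent e) (h : ¬ IsReal e) :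
    e * wreathRep O G sigma e = 0 := by
  rw [isReal_iff he] at h
  rcases he.mul_eq_zero_or_eq he.sigma.central he.sigma.idem with h1 | h1
  · exact h1
  rcases he.sigma.mul_eq_zero_or_eq he.central he.idem with h2 | h2
  · rwa [Subalgebra.mem_center_iff.mp he.sigma.central]
  · exact absurd (by rw [← h2, ← Subalgebra.mem_center_iff.mp he.sigma.central, h1]) h

open Classical in
/-- The idempotent `E` with `B + B° = E O[G]`: it is `e` if the block is real, and `e + e^σ`
otherwise. -/
def hull (e : O[G]) : O[G] := if IsReal e then e else e + wreathRep O G sigma e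

theorem hull_of_isReal {e : O[G]} (h : IsReal e) : hull e = e := if_pos h

theorem hull_of_not_isReal {e : O[G]} (h : ¬ IsReal e) : hull e = e + wreathRep O G sigma e :=
  if_neg h

theorem hull_mem_center {e : O[G]} (he : IsBlockIdempotent e) :
    hull e ∈ Subalgebra.center O O[G] := by
  by_cases h : IsReal e
  · rw [hull_of_isReal h]; exact he.central
  · rw [hull_of_not_isReal h]; exact add_mem he.central he.sigma.central

theorem sigma_hull {e : O[G]} (he : IsBlockIdempotent e) :
    wreathRep O G sigma (hull e) = hull e := by
  by_cases h : IsReal e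
  · rw [hull_of_isReal h, (isReal_iff he).mp h]
  · rw [hull_of_not_isReal h, map_add, sigma_sigma, add_comm]

theorem hull_idem {e : O[G]} (he : IsBlockIdempotent e) : IsIdempotentElem (hull e) := by
  by_cases h : IsReal e
  · rw [hull_of_isReal h]; exact he.idem
  · have h1 := mul_sigma_eq_zero he h
    have h2 := (Subalgebra.mem_center_iff.mp he.sigma.central e).symm.trans h1
    rw [hull_of_not_isReal h, IsIdempotentElem, add_mul, mul_add, mul_add, h1, h2, he.idem.eq,
      he.sigma.idem.eq]
    simp

theorem mul_hull {e : O[G]} (he : IsBlockIdempotent e) : e * hull e = e := by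
  by_cases h : IsReal e
  · rw [hull_of_isReal h]; exact he.idem
  · rw [hull_of_not_isReal h, mul_add, mul_sigma_eq_zero he h, he.idem.eq, add_zero]

theorem hull_mul_eq_zero {e t : O[G]} (ht : t ∈ Subalgebra.center O O[G])
    (hs : wreathRep O G sigma t = t) (h0 : e * t = 0) : hull e * t = 0 := by
  by_cases h : IsReal e
  · rw [hull_of_isReal h, h0]
  · rw [hull_of_not_isReal h, add_mul, h0, zero_add]
    conv_lhs => rw [← hs]
    rw [← sigma_mul, ← Subalgebra.mem_center_iff.mp ht, h0, map_zero]

theorem mem_blockSum_iff {e : O[G]} (he : IsBlockIdempotent e) {x : O[G]} :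
    x ∈ (blockSum he).toSubmodule ↔ hull e * x = x := by
  by_cases h : IsReal e
  · rw [blockSum_toSubmodule_of_isReal he h, hull_of_isReal h, mem_block_iff he.idem]
  · change x ∈ block e ⊔ oppBlock e ↔ _
    have h1 := mul_sigma_eq_zero he h
    have h2 := (Subalgebra.mem_center_iff.mp he.sigma.central e).symm.trans h1
    rw [oppBlock_eq he, hull_of_not_isReal h]
    constructor
    · intro hx
      obtain ⟨y, hy, z, hz, rfl⟩ := Submodule.mem_sup.mp hx
      rw [mem_block_iff he.idem] at hy
      rw [mem_block_iff he.sigma.idem] at hz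
      have h3 : wreathRep O G sigma e * y = 0 := by rw [← hy, ← mul_assoc, h2, zero_mul]
      have h4 : e * z = 0 := by rw [← hz, ← mul_assoc, h1, zero_mul]
      rw [add_mul, mul_add, mul_add, hy, hz, h3, h4]
      simp
    · intro hx
      rw [← hx, add_mul]
      exact Submodule.add_mem_sup ⟨x, rfl⟩ ⟨x, rfl⟩

end Hull

section Indecomposable

variable {O G : Type*} [CommRing O] [Group G]

/-- The projection of `O[G]` onto `B + B°` that is given by multiplication with `hull e`. -/
def toBlockSum {e : O[G]} (he : IsBlockIdempotent e) : O[G] →ₗ[O] (blockSum he).toSubmodule :=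
  LinearMap.codRestrict _ (LinearMap.mulLeft O (hull e)) fun x => by
    rw [mem_blockSum_iff, LinearMap.mulLeft_apply, ← mul_assoc, (hull_idem he).eq]

theorem coe_toBlockSum {e : O[G]} (he : IsBlockIdempotent e) (x : O[G]) :
    (toBlockSum he x : O[G]) = hull e * x := rfl

theorem toBlockSum_coe {e : O[G]} (he : IsBlockIdempotent e) (m : (blockSum he).toSubmodule) :
    toBlockSum he m = m :=
  Subtype.ext ((mem_blockSum_iff he).mp m.2)

theorem coe_blockSumRep {e : O[G]} (he : IsBlockIdempotent e) (w : Wreath G)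
    (m : (blockSum he).toSubmodule) : (blockSumRep he w m : O[G]) = wreathRep O G w m := rfl

theorem toBlockSum_wreathRep {e : O[G]} (he : IsBlockIdempotent e) (w : Wreath G) (x : O[G]) :
    toBlockSum he (wreathRep O G w x) = blockSumRep he w (toBlockSum he x) :=
  Subtype.ext (wreathRep_mul_of_mem_center (hull_mem_center he) (sigma_hull he) w x).symm

theorem projection_equivariant {A Γ M : Type*} [CommRing A] [Group Γ] [AddCommGroup M] [Module A M]
    {ρ : Representation A Γ M} {N₁ N₂ : Subrepresentation ρ}
    (h : IsCompl N₁.toSubmodule N₂.toSubmodule) (g : Γ) (m : M) :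
    N₁.toSubmodule.projection N₂.toSubmodule h (ρ g m) =
      ρ g (N₁.toSubmodule.projection N₂.toSubmodule h m) := by
  set π := N₁.toSubmodule.projection N₂.toSubmodule h
  have h1 : ρ g (π m) ∈ N₁.toSubmodule :=
    N₁.apply_mem_toSubmodule g (Submodule.projection_apply_mem h m)
  have h2 : ρ g (m - π m) ∈ N₂.toSubmodule :=
    N₂.apply_mem_toSubmodule g (Submodule.sub_projection_mem h m)
  calc π (ρ g m) = π (ρ g (π m)) + π (ρ g (m - π m)) := by rw [← map_add, ← map_add]; simp
    _ = ρ g (π m) := by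
      rw [(Submodule.projection_eq_self_iff h _).mpr h1,
        (Submodule.projection_apply_eq_zero_iff h).mpr h2, add_zero]

/-- The projection onto a direct summand of `B + B°` is multiplication by a central idempotent,
which either kills `e` or fixes it. -/
theorem blockSumRep_isIndecomposable {e : O[G]} (he : IsBlockIdempotent e) :
    IsIndecomposable (blockSumRep he) := by
  have hcomm := Subalgebra.mem_center_iff.mp (hull_mem_center he)
  have hee : hull e * e = e := by rw [← hcomm, mul_hull he]
  refine ⟨⟨⟨e, (mem_blockSum_iff he).mpr hee⟩, 0, fun h => he.ne_zero (congrArg Subtype.val h)⟩,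
    fun N₁ N₂ hN => ?_⟩
  have h : IsCompl N₁.toSubmodule N₂.toSubmodule := by
    refine .of_eq ?_ ?_
    · exact congrArg Subrepresentation.toSubmodule hN.inf_eq_bot
    · exact congrArg Subrepresentation.toSubmodule hN.sup_eq_top
  set π := N₁.toSubmodule.projection N₂.toSubmodule h with hπ
  let T : O[G] →ₗ[O] O[G] := (blockSum he).toSubmodule.subtype ∘ₗ π ∘ₗ toBlockSum he
  have hT : ∀ x, T x = π (toBlockSum he x) := fun x => rfl
  obtain ⟨hc, hs, hmul⟩ := eq_mul_of_equivariant T fun w x => by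
    rw [hT, hT, toBlockSum_wreathRep, hπ, projection_equivariant, coe_blockSumRep]
  have hmul' : ∀ m : (blockSum he).toSubmodule, (π m : O[G]) = T 1 * m := by
    intro m
    rw [← hmul, hT, toBlockSum_coe]
  have hT1 : hull e * T 1 = T 1 := (mem_blockSum_iff he).mp (Subtype.prop _)
  have hid : IsIdempotentElem (T 1) := by
    rw [IsIdempotentElem, ← hmul, hT (T 1)]
    have : toBlockSum he (T 1) = π (toBlockSum he 1) := Subtype.ext hT1
    rw [this, hT]
    congr 1
    exact (Submodule.projection_eq_self_iff h _).mpr (Submodule.projection_apply_mem h _)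
  rcases he.mul_eq_zero_or_eq hc hid with h0 | h0
  · left
    have h1 : T 1 = 0 := by rw [← hT1, hull_mul_eq_zero hc hs h0]
    refine Subrepresentation.toSubmodule_injective ((Submodule.eq_bot_iff _).mpr fun m hm => ?_)
    rw [← (Submodule.projection_eq_self_iff h m).mpr hm]
    exact Subtype.ext (by rw [hmul', h1, zero_mul]; rfl)
  · right
    have h1 : hull e * T 1 = hull e := by
      have := hull_mul_eq_zero (e := e) (sub_mem (one_mem _) hc)
        (by rw [map_sub, hs, MonoidAlgebra.one_def, wreathRep_single, sigma_smul, inv_one])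
        (by rw [mul_sub, h0, mul_one, sub_self])
      rw [mul_sub, mul_one, sub_eq_zero] at this
      exact this.symm
    refine Subrepresentation.toSubmodule_injective ((Submodule.eq_bot_iff _).mpr fun m hm => ?_)
    have h2 := (Submodule.projection_apply_eq_zero_iff h).mpr hm
    refine Subtype.ext ?_
    rw [← (mem_blockSum_iff he).mp m.2, ← h1, hT1, ← hmul']
    exact congrArg Subtype.val h2

/-- Higman's criterion for `B + B°`, in terms of endomorphisms of the whole group algebra. -/
theorem isRelProjective_blockSumRep_iff [Finite G] {e : O[G]} (he : IsBlockIdempotent e)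
    (H : Subgroup (Wreath G)) [Fintype (Wreath G ⧸ H)] :
    IsRelProjective (blockSumRep he) H ↔ ∃ θ : O[G] →ₗ[O] O[G],
      (∀ h ∈ H, ∀ x, θ (wreathRep O G h x) = wreathRep O G h (θ x)) ∧
      ∀ x, ∑ q : Wreath G ⧸ H, wreathRep O G q.out (θ (wreathRep O G q.out⁻¹ x)) = hull e * x := by
  have : Finite (Wreath G) := Finite.of_equiv _ SemidirectProduct.equivProd.symm
  rw [isRelProjective_iff]
  constructor
  · rintro ⟨θ, hθ, hid⟩
    refine ⟨(blockSum he).toSubmodule.subtype ∘ₗ θ ∘ₗ toBlockSum he, ?_, ?_⟩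
    · intro h hh x
      simp only [LinearMap.comp_apply, toBlockSum_wreathRep, hθ h hh, Submodule.subtype_apply,
        coe_blockSumRep]
    · intro x
      rw [← coe_toBlockSum he x, ← hid (toBlockSum he x), ← Submodule.subtype_apply, map_sum]
      simp only [LinearMap.comp_apply, toBlockSum_wreathRep, Submodule.subtype_apply,
        coe_blockSumRep]
  · rintro ⟨θ, hθ, hid⟩
    refine ⟨toBlockSum he ∘ₗ θ ∘ₗ (blockSum he).toSubmodule.subtype, ?_, ?_⟩
    · intro h hh m
      simp only [LinearMap.comp_apply, Submodule.subtype_apply, coe_blockSumRep, hθ h hh,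
        toBlockSum_wreathRep]
    · intro m
      simp only [LinearMap.comp_apply, Submodule.subtype_apply, coe_blockSumRep,
        ← toBlockSum_wreathRep]
      rw [← map_sum, hid, ← coe_toBlockSum he, toBlockSum_coe, toBlockSum_coe]

end Indecomposable

/-! ### Relative projectivity and class sums -/

section OrbitSum

variable {O G : Type*} [CommRing O]

open Classical in
/-- The sum in the group algebra of the elements of the `r`-class of `c`. -/
def orbitSum (O : Type*) [CommRing O] [Finite G] (r : Setoid G) (c : G) : O[G] :=
  MonoidAlgebra.ofCoeff (Finsupp.equivFunOnFinite.symm fun y => if r c y then 1 else 0)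

open Classical in
theorem coeff_orbitSum [Finite G] (r : Setoid G) (c y : G) :
    (orbitSum O r c).coeff y = if r c y then 1 else 0 := rfl

variable [Group G]

variable (G) in
/-- Two elements `c` and `d` are related if `(1, c)` and `(1, d)` are conjugate under the wreath
product. -/
def wreathSetoid : Setoid G :=
  (MulAction.orbitRel (Wreath G) (G × G)).comap fun y => (1, y)

theorem wreathSetoid_iff {c d : G} : wreathSetoid G c d ↔ IsConj c d ∨ IsConj c⁻¹ d := by
  change (1, c) ∈ MulAction.orbit (Wreath G) ((1, d) : G × G) ↔ _
  constructor
  · rintro ⟨w, hw⟩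
    have h1 : w • (1 : G) = 1 := congrArg Prod.fst hw
    have h2 : w • d = c := congrArg Prod.snd hw
    rcases wreath_cases w with ⟨a, b, rfl⟩ | ⟨a, b, rfl⟩
    · rw [inl_smul] at h1 h2
      have : a = b := by simpa [mul_inv_eq_one] using h1
      subst this
      exact .inl (IsConj.symm (isConj_iff.mpr ⟨a, h2⟩))
    · rw [mul_smul, sigma_smul, inl_smul] at h1 h2
      have : a = b := by simpa [mul_inv_eq_one] using h1
      subst this
      refine .inr (IsConj.symm (isConj_iff.mpr ⟨a, ?_⟩))
      rw [← h2]
      group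
  · rintro (h | h)
    · obtain ⟨a, ha⟩ := isConj_iff.mp h.symm
      exact ⟨diag a, Prod.ext (by simp [diag_smul]) (by simp [diag_smul, ha])⟩
    · obtain ⟨a, ha⟩ := isConj_iff.mp h.symm
      refine ⟨diag a * sigma, Prod.ext (by simp [diag_smul, mul_smul, sigma_smul]) ?_⟩
      simp only [Prod.smul_mk, mul_smul, sigma_smul, diag_smul]
      rw [← inv_inj, ← ha]
      group

theorem coeff_eq_of_isConj {x : O[G]} (hx : x ∈ Subalgebra.center O O[G]) {c d : G}
    (h : IsConj c d) : x.coeff c = x.coeff d := by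
  obtain ⟨g, rfl⟩ := isConj_iff.mp h
  exact (mem_center_iff_coeff.mp hx g c).symm

theorem coeff_eq_of_wreathSetoid {x : O[G]} (hx : x ∈ Subalgebra.center O O[G])
    (hs : wreathRep O G sigma x = x) {c d : G} (h : wreathSetoid G c d) :
    x.coeff c = x.coeff d := by
  rcases wreathSetoid_iff.mp h with h | h
  · exact coeff_eq_of_isConj hx h
  · rw [← coeff_eq_of_isConj hx h, ← coeff_sigma, hs]

variable [Finite G]

theorem orbitSum_mem_center (r : Setoid G) (hr : ∀ c d, IsConj c d → r c d) (c : G) :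
    orbitSum O r c ∈ Subalgebra.center O O[G] := by
  classical
  rw [mem_center_iff_coeff]
  intro g h
  rw [coeff_orbitSum, coeff_orbitSum]
  congr 1
  have : r h (g * h * g⁻¹) := hr _ _ (isConj_iff.mpr ⟨g, rfl⟩)
  exact propext ⟨fun H => r.trans H (r.symm this), fun H => r.trans H this⟩

variable (O) in
/-- The sum of the conjugacy class of `c`, as an element of the centre of the group algebra. -/
def classSum (c : G) : Subalgebra.center O O[G] :=
  ⟨orbitSum O (IsConj.setoid G) c, orbitSum_mem_center _ (fun _ _ h => h) c⟩

variable (O) in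
/-- The sum of the conjugates of `c` and of `c⁻¹`, each counted once, as an element of the centre
of the group algebra. -/
def realClassSum (c : G) : Subalgebra.center O O[G] :=
  ⟨orbitSum O (wreathSetoid G) c,
    orbitSum_mem_center _ (fun _ _ h => wreathSetoid_iff.mpr (.inl h)) c⟩

theorem sigma_realClassSum (c : G) :
    wreathRep O G sigma (realClassSum O c : O[G]) = realClassSum O c := by
  classical
  ext y
  rw [coeff_sigma]
  change (if wreathSetoid G c y⁻¹ then (1 : O) else 0) = if wreathSetoid G c y then 1 else 0
  have : wreathSetoid G y⁻¹ y := wreathSetoid_iff.mpr (.inr (by rw [inv_inv]))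
  congr 1
  exact propext ⟨fun H => (wreathSetoid G).trans H this,
    fun H => (wreathSetoid G).trans H ((wreathSetoid G).symm this)⟩

theorem realClassSum_of_isConj {c : G} (h : IsConj c c⁻¹) : realClassSum O c = classSum O c := by
  classical
  ext y
  change (if wreathSetoid G c y then (1 : O) else 0) = if IsConj c y then 1 else 0
  congr 1
  rw [wreathSetoid_iff]
  exact propext ⟨fun H => H.elim id h.trans, .inl⟩

theorem realClassSum_of_not_isConj {c : G} (h : ¬ IsConj c c⁻¹) :
    realClassSum O c = classSum O c + classSum O c⁻¹ := by
  classical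
  ext y
  change (if wreathSetoid G c y then (1 : O) else 0) =
    (if IsConj c y then 1 else 0) + if IsConj c⁻¹ y then 1 else 0
  rw [if_congr wreathSetoid_iff rfl rfl]
  by_cases h1 : IsConj c y <;> by_cases h2 : IsConj c⁻¹ y
  · exact absurd (h1.trans h2.symm) h
  all_goals simp only [h1, h2, if_true, if_false, or_true, true_or, or_self, add_zero, zero_add]

theorem sigma_classSum (c : G) :
    wreathRep O G sigma (classSum O c : O[G]) = classSum O c⁻¹ := by
  classical
  ext y
  rw [coeff_sigma]
  change (if IsConj c y⁻¹ then (1 : O) else 0) = if IsConj c⁻¹ y then 1 else 0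
  congr 1
  simp only [isConj_iff]
  refine propext (exists_congr fun g => ?_)
  rw [← inv_inj, inv_inv, mul_inv_rev, mul_inv_rev, inv_inv, mul_assoc]

theorem classSum_eq_of_isConj {c d : G} (h : IsConj c d) : classSum O c = classSum O d := by
  classical
  ext y
  change (if IsConj c y then (1 : O) else 0) = if IsConj d y then 1 else 0
  congr 1
  exact propext ⟨h.symm.trans, h.trans⟩

theorem realClassSum_eq_of_isConj {c d : G} (h : IsConj c d) :
    realClassSum O c = realClassSum O d := by
  classical
  ext y
  change (if wreathSetoid G c y then (1 : O) else 0) = if wreathSetoid G d y then 1 else 0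
  congr 1
  have h1 : wreathSetoid G c d := wreathSetoid_iff.mpr (.inl h)
  exact propext ⟨(wreathSetoid G).trans ((wreathSetoid G).symm h1), (wreathSetoid G).trans h1⟩

variable [IsLocalRing O]

/-- If a character of the centre does not vanish on `z`, then it does not vanish on one of the class
sums that occur in `z` with a nonzero coefficient modulo the maximal ideal. -/
theorem exists_coeff_ne_zero (φ : Subalgebra.center O O[G] →ₐ[O] ResidueField O) (r : Setoid G)
    (hr : ∀ c d, IsConj c d → r c d) (z : Subalgebra.center O O[G])
    (hz : ∀ c d, r c d → z.1.coeff c = z.1.coeff d) (hφ : φ z ≠ 0) :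
    ∃ c, residue O (z.1.coeff c) ≠ 0 ∧ φ ⟨orbitSum O r c, orbitSum_mem_center r hr c⟩ ≠ 0 := by
  classical
  have : Fintype (Quotient r) := Fintype.ofFinite _
  have hexp : z = ∑ q : Quotient r,
      z.1.coeff q.out • (⟨orbitSum O r q.out, orbitSum_mem_center r hr q.out⟩ :
        Subalgebra.center O O[G]) := by
    refine Subtype.ext ?_
    rw [AddSubmonoidClass.coe_finsetSum]
    ext y
    rw [MonoidAlgebra.coeff_sum, Finsupp.finsetSum_apply, Finset.sum_eq_single (⟦y⟧ : Quotient r)]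
    · have hy : r (⟦y⟧ : Quotient r).out y := Quotient.mk_out y
      change _ = z.1.coeff _ * (if r (⟦y⟧ : Quotient r).out y then (1 : O) else 0)
      rw [if_pos hy, mul_one, hz _ _ hy]
    · intro q _ hq
      change z.1.coeff _ * (if r q.out y then (1 : O) else 0) = 0
      rw [if_neg, mul_zero]
      intro h
      refine hq ?_
      rw [← Quotient.out_eq q]
      exact Quotient.sound h
    · simp
  rw [hexp, map_sum] at hφ
  obtain ⟨q, -, hq⟩ := Finset.exists_ne_zero_of_sum_ne_zero hφ
  refine ⟨q.out, ?_, ?_⟩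
  · intro h
    refine hq ?_
    rw [map_smul, Algebra.smul_def, ResidueField.algebraMap_eq, h, zero_mul]
  · intro h
    exact hq (by rw [map_smul, h, smul_zero])

end OrbitSum

section Trace

variable {O G : Type*} [CommRing O] [Group G] [Finite G]

instance : Finite (Wreath G) := Finite.of_equiv _ SemidirectProduct.equivProd.symm

theorem trace_equivariant {A Γ M : Type*} [CommRing A] [Group Γ] [AddCommGroup M] [Module A M]
    (ρ : Representation A Γ M) (H : Subgroup Γ) [Fintype (Γ ⧸ H)] (θ : M →ₗ[A] M)
    (hθ : ∀ h ∈ H, ∀ m, θ (ρ h m) = ρ h (θ m)) (g : Γ) (m : M) :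
    ∑ q : Γ ⧸ H, ρ q.out (θ (ρ q.out⁻¹ (ρ g m))) =
      ρ g (∑ q : Γ ⧸ H, ρ q.out (θ (ρ q.out⁻¹ m))) := by
  have hρ : ∀ v w m, ρ (v * w) m = ρ v (ρ w m) := fun v w m => by rw [map_mul]; rfl
  rw [← sum_quotient_mul_left H (fun w => ρ w (θ (ρ w⁻¹ (ρ g m)))) _ g, map_sum]
  · refine Finset.sum_congr rfl fun q _ => ?_
    rw [← hρ _ g, hρ g]
    congr 4
    group
  · intro w h hh
    rw [mul_inv_rev, hρ h⁻¹, hθ _ (H.inv_mem hh), ← hρ (w * h)]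
    congr 2
    group

/-- The trace from `V` of the matrix unit that maps `p.1` to `p.2` is a multiple of multiplication
by `realClassSum O c`; if the multiple is a unit and `b` inverts this sum on `B + B°`, then `B + B°`
is relatively `V`-projective. -/
theorem isRelProjective_blockSumRep {e : O[G]} (he : IsBlockIdempotent e) (c : G) {p : G × G}
    (hp : p ∈ MulAction.orbit (Wreath G) ((1, c) : G × G)) {V : Subgroup (Wreath G)}
    (hV : V ≤ MulAction.stabilizer (Wreath G) p)
    (hu : IsUnit ((V.relIndex (MulAction.stabilizer (Wreath G) p) : ℕ) : O)) {b : O[G]}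
    (hb : b ∈ Subalgebra.center O O[G]) (hbs : wreathRep O G sigma b = b)
    (hcb : (realClassSum O c : O[G]) * b = hull e) : IsRelProjective (blockSumRep he) V := by
  classical
  have : Fintype (Wreath G ⧸ V) := Fintype.ofFinite _
  set n : O := ((V.relIndex (MulAction.stabilizer (Wreath G) p) : ℕ) : O)
  obtain ⟨u, hu⟩ := hu.exists_left_inv
  -- The matrix unit of `p`, which commutes with the stabilizer of `p`.
  let θ₀ : O[G] →ₗ[O] O[G] := {
    toFun x := x.coeff p.1 • MonoidAlgebra.single p.2 1
    map_add' x y := by rw [MonoidAlgebra.coeff_add, Finsupp.add_apply, add_smul]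
    map_smul' a x := by
      rw [MonoidAlgebra.coeff_smul, Finsupp.smul_apply, smul_assoc, RingHom.id_apply] }
  have hθ₀ : ∀ x, θ₀ x = x.coeff p.1 • MonoidAlgebra.single p.2 1 := fun x => rfl
  have heq : ∀ h ∈ V, ∀ x, θ₀ (wreathRep O G h x) = wreathRep O G h (θ₀ x) := by
    intro h hh x
    have h1 : h • p = p := hV hh
    have h2 : h⁻¹ • p.1 = p.1 := by rw [inv_smul_eq_iff]; exact (congrArg Prod.fst h1).symm
    have h3 : h • p.2 = p.2 := congrArg Prod.snd h1
    rw [hθ₀, hθ₀, map_smul, wreathRep_single, coeff_wreathRep, h2, h3]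
  let T : O[G] →ₗ[O] O[G] := ∑ q : Wreath G ⧸ V,
    wreathRep O G q.out ∘ₗ θ₀ ∘ₗ wreathRep O G q.out⁻¹
  have hT : ∀ x, T x = ∑ q : Wreath G ⧸ V, wreathRep O G q.out (θ₀ (wreathRep O G q.out⁻¹ x)) := by
    intro x
    simp only [T, LinearMap.sum_apply, LinearMap.comp_apply]
  have hT1 : T 1 = n • (realClassSum O c : O[G]) := by
    rw [hT]
    ext y
    have h1 : ∀ q : Wreath G ⧸ V, (wreathRep O G q.out
        (θ₀ (wreathRep O G q.out⁻¹ 1))).coeff y = if q.out • p = (1, y) then 1 else 0 := by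
      intro q
      rw [hθ₀, map_smul, wreathRep_single, coeff_wreathRep, inv_inv, MonoidAlgebra.one_def,
        MonoidAlgebra.coeff_smul, Finsupp.smul_apply, MonoidAlgebra.coeff_single,
        MonoidAlgebra.coeff_single, Finsupp.single_apply, Finsupp.single_apply, smul_eq_mul,
        ite_zero_mul_ite_zero, mul_one]
      congr 1
      rw [Prod.ext_iff, eq_comm (a := (1 : G))]
      rfl
    rw [MonoidAlgebra.coeff_sum, Finsupp.finsetSum_apply, Finset.sum_congr rfl fun q _ => h1 q,
      Finset.sum_boole]
    change _ = n * (if wreathSetoid G c y then (1 : O) else 0)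
    split_ifs with hy
    · have hy' : (1, y) ∈ MulAction.orbit (Wreath G) p := by
        rw [MulAction.orbit_eq_iff.mpr hp, MulAction.mem_orbit_symm]
        exact hy
      rw [mul_one, ← Fintype.card_subtype, ← Nat.card_eq_fintype_card]
      exact congrArg Nat.cast (card_quotient_smul_eq V p (1, y) hV hy')
    · rw [mul_zero, Finset.filter_eq_empty_iff.mpr, Finset.card_empty, Nat.cast_zero]
      intro q _ hq
      refine hy ?_
      change (1, c) ∈ MulAction.orbit (Wreath G) ((1, y) : G × G)
      rw [MulAction.mem_orbit_symm, ← MulAction.orbit_eq_iff.mpr hp, ← hq]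
      exact MulAction.mem_orbit _ _
  have hTx := (eq_mul_of_equivariant T fun w x => by
    rw [hT, hT]; exact trace_equivariant _ V θ₀ heq w x).2.2
  rw [isRelProjective_blockSumRep_iff he]
  refine ⟨u • θ₀ ∘ₗ LinearMap.mulLeft O b, ?_, ?_⟩
  · intro h hh x
    rw [LinearMap.smul_apply, LinearMap.smul_apply, LinearMap.comp_apply, LinearMap.comp_apply,
      LinearMap.mulLeft_apply, LinearMap.mulLeft_apply, ← wreathRep_mul_of_mem_center hb hbs,
      heq h hh, map_smul]
  · intro x
    simp only [LinearMap.smul_apply, LinearMap.comp_apply, LinearMap.mulLeft_apply, map_smul,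
      ← wreathRep_mul_of_mem_center hb hbs]
    rw [← Finset.smul_sum, ← hT, hTx, hT1, smul_mul_assoc, smul_smul, hu, one_smul, ← mul_assoc,
      hcb]

theorem sum_quotient_single_conj (c : G) {V : Subgroup G} [Fintype (G ⧸ V)]
    (hV : V ≤ Subgroup.centralizer {c}) :
    ∑ q : G ⧸ V, (MonoidAlgebra.single (q.out * c * q.out⁻¹) 1 : O[G]) =
      (V.relIndex (Subgroup.centralizer {c}) : O) • (classSum O c : O[G]) := by
  classical
  ext y
  rw [MonoidAlgebra.coeff_sum, Finsupp.finsetSum_apply]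
  simp only [MonoidAlgebra.coeff_single, Finsupp.single_apply]
  rw [Finset.sum_boole]
  change _ = _ * (if IsConj c y then (1 : O) else 0)
  split_ifs with hy
  · have hst : (MulAction.stabilizer (ConjAct G) c : Subgroup G) =
        Subgroup.centralizer {c} := by
      ext g
      exact mul_inv_eq_iff_eq_mul.trans (Subgroup.mem_centralizer_singleton_iff (G := G)).symm
    have hfin : Finite (ConjAct G) := inferInstanceAs (Finite G)
    let V' : Subgroup (ConjAct G) := V
    have hcard := card_quotient_smul_eq V' c y (hV.trans hst.ge) (by
      obtain ⟨g, hg⟩ := isConj_iff.mp hy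
      exact ⟨ConjAct.toConjAct g, hg⟩)
    rw [mul_one, ← Fintype.card_subtype, ← Nat.card_eq_fintype_card, ← hst]
    exact congrArg Nat.cast hcard
  · rw [mul_zero, Finset.filter_eq_empty_iff.mpr, Finset.card_empty, Nat.cast_zero]
    intro q _ hq
    exact hy (isConj_iff.mpr ⟨_, hq⟩)

/-- If `b` inverts the class sum of `c` in the block, then `c * b` has as its trace from a subgroup
`V` of the centralizer of `c` a multiple of `e`, by the index of `V`. -/
theorem isTraceFrom_of_classSum_mul {e : O[G]} (c : G) {V : Subgroup G}
    (hV : V ≤ Subgroup.centralizer {c})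
    (hu : IsUnit ((V.relIndex (Subgroup.centralizer {c}) : ℕ) : O)) {b : O[G]}
    (hb : b ∈ Subalgebra.center O O[G]) (hcb : (classSum O c : O[G]) * b = e) :
    IsTraceFrom e V := by
  classical
  have : Fintype (G ⧸ V) := Fintype.ofFinite _
  obtain ⟨u, hu⟩ := hu.exists_left_inv
  have hbc := Subalgebra.mem_center_iff.mp hb
  have hconj : ∀ g : G, MonoidAlgebra.of O G g * (u • (MonoidAlgebra.single c 1 * b)) *
      MonoidAlgebra.of O G g⁻¹ = u • (MonoidAlgebra.single (g * c * g⁻¹) 1 * b) := by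
    intro g
    rw [mul_smul_comm, smul_mul_assoc, mul_assoc, mul_assoc, ← hbc, ← mul_assoc, ← mul_assoc]
    simp
  refine ⟨u • (MonoidAlgebra.single c 1 * b), ?_, ?_⟩
  · intro d hd
    rw [hconj, mul_inv_eq_of_eq_mul]
    exact (Subgroup.mem_centralizer_singleton_iff.mp (hV hd))
  · rw [relTrace, finsum_eq_sum_of_fintype, Finset.sum_congr rfl fun q _ => hconj q.out,
      ← Finset.smul_sum, ← Finset.sum_mul]
    rw [sum_quotient_single_conj c hV, smul_mul_assoc, smul_smul, hu, one_smul, hcb]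

variable [IsLocalRing O] [CharP (ResidueField O) 2]

/-- If `c` occurs in the idempotent of `B + B°` modulo the maximal ideal, then a subgroup relative
to which `B + B°` is projective contains, up to conjugation, all `2`-subgroups of the stabilizer of
`(1, c)`. -/
theorem exists_conj_mem_of_isRelProjective {e : O[G]} (he : IsBlockIdempotent e)
    {H : Subgroup (Wreath G)} (hH : IsRelProjective (blockSumRep he) H) {c : G}
    (hc : residue O ((hull e).coeff c) ≠ 0) {P : Subgroup (Wreath G)}
    (hP : P ≤ MulAction.stabilizer (Wreath G) ((1, c) : G × G)) (hP2 : IsPGroup 2 P) :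
    ∃ w, ∀ x ∈ P, w⁻¹ * x * w ∈ H := by
  classical
  have : Fintype (Wreath G ⧸ H) := Fintype.ofFinite _
  obtain ⟨θ, hθ, hsum⟩ := (isRelProjective_blockSumRep_iff he H).mp hH
  refine exists_conj_mem_of_sum_quotient_ne_zero (k := ResidueField O) (p := 2) H P hP2
    (fun w => residue O ((θ (MonoidAlgebra.single (w⁻¹ • 1) 1)).coeff (w⁻¹ • c))) ?_ ?_ ?_
  · intro w h hh
    rw [mul_inv_rev, mul_smul, mul_smul, ← wreathRep_single, hθ _ (H.inv_mem hh), coeff_wreathRep,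
      inv_inv, smul_inv_smul]
  · intro w x hx
    have h1 : x⁻¹ • ((1, c) : G × G) = (1, c) := hP (P.inv_mem hx)
    have h2 : x⁻¹ • (1 : G) = 1 := congrArg Prod.fst h1
    have h3 : x⁻¹ • c = c := congrArg Prod.snd h1
    rw [mul_inv_rev, mul_smul, mul_smul, h2, h3]
  · have h1 := congrArg (fun x : O[G] => x.coeff c) (hsum 1)
    simp only [MonoidAlgebra.coeff_sum, Finsupp.finsetSum_apply, MonoidAlgebra.one_def,
      wreathRep_single, coeff_wreathRep] at h1
    rw [← map_sum, h1]
    simpa [← MonoidAlgebra.one_def] using hc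

/-- If `c` occurs in `e` modulo the maximal ideal and `e` is a trace from `H`, then `H` contains, up
to conjugation, all `2`-subgroups of the centralizer of `c`. -/
theorem exists_conj_mem_of_isTraceFrom {e : O[G]} {H : Subgroup G} (hH : IsTraceFrom e H) {c : G}
    (hc : residue O (e.coeff c) ≠ 0) {P : Subgroup G} (hP : P ≤ Subgroup.centralizer {c})
    (hP2 : IsPGroup 2 P) : ∃ g, ∀ x ∈ P, g⁻¹ * x * g ∈ H := by
  classical
  have : Fintype (G ⧸ H) := Fintype.ofFinite _
  obtain ⟨a, ha, hsum⟩ := hH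
  have hcoeff : ∀ g h : G, (MonoidAlgebra.of O G g * a * MonoidAlgebra.of O G g⁻¹).coeff h =
      a.coeff (g⁻¹ * h * g) := by
    intro g h
    simp [mul_assoc]
  refine exists_conj_mem_of_sum_quotient_ne_zero (k := ResidueField O) (p := 2) H P hP2
    (fun g => residue O (a.coeff (g⁻¹ * c * g))) ?_ ?_ ?_
  · intro w h hh
    conv_rhs => rw [← ha h hh, hcoeff]
    congr 2
    group
  · intro w x hx
    have h1 := Subgroup.mem_centralizer_singleton_iff.mp (hP hx)
    have h2 : x⁻¹ * c * x = c := by rw [mul_assoc, ← h1]; simp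
    rw [show (x * w)⁻¹ * c * (x * w) = w⁻¹ * (x⁻¹ * c * x) * w by group, h2]
  · have h1 := congrArg (fun x : O[G] => x.coeff c) hsum
    simp only [relTrace, finsum_eq_sum_of_fintype, MonoidAlgebra.coeff_sum,
      Finsupp.finsetSum_apply, hcoeff] at h1
    rw [← map_sum, h1]
    exact hc

end Trace

/-! ### The central character of a block -/

theorem isUnit_natCast_of_odd {O : Type*} [CommRing O] [IsLocalRing O]
    [CharP (ResidueField O) 2] {n : ℕ} (hn : ¬ 2 ∣ n) : IsUnit (n : O) := by
  rw [← residue_ne_zero_iff_isUnit, map_natCast, Ne, CharP.cast_eq_zero_iff (ResidueField O) 2]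
  exact hn

section Character

variable {O G : Type*} [CommRing O] [IsLocalRing O] [Group G]

/-- `φ` is the central character of the block with idempotent `e`: it maps `e` to `1`, and every
central element on which it does not vanish is invertible modulo the other blocks. -/
structure IsCentralCharacter {e : O[G]} (he : IsBlockIdempotent e)
    (φ : Subalgebra.center O O[G] →ₐ[O] ResidueField O) : Prop where
  map_idem : φ ⟨e, he.central⟩ = 1
  exists_mul_eq : ∀ z, φ z ≠ 0 → ∃ b, z * b = ⟨e, he.central⟩

theorem exists_isCentralCharacter [IsNoetherianRing O] [IsAdicComplete (maximalIdeal O) O]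
    [IsAlgClosed (ResidueField O)] [Finite G] {e : O[G]} (he : IsBlockIdempotent e) :
    ∃ φ, IsCentralCharacter he φ := by
  have h1 : Module.Finite O O[G] :=
    Module.Finite.equiv (MonoidAlgebra.coeffLinearEquiv (S := O) (R := O) (M := G)).symm
  have : Module.Finite O (Subalgebra.center O O[G]) :=
    Module.IsNoetherian.finite O (Subalgebra.center O O[G]).toSubmodule
  obtain ⟨φ, h1, h2⟩ := exists_algHom_residueField (O := O)
    (⟨e, he.central⟩ : Subalgebra.center O O[G]) (Subtype.ext he.idem)
    (fun h => he.ne_zero (congrArg Subtype.val h)) (by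
      rintro ⟨t, ht⟩ hti
      rcases he.mul_eq_zero_or_eq ht (congrArg Subtype.val hti) with h | h
      · exact .inl (Subtype.ext h)
      · refine .inr (Subtype.ext ?_)
        change e * (1 - t) = 0
        rw [mul_sub, h, mul_one, sub_self])
  exact ⟨φ, h1, h2⟩

variable {e : O[G]} {he : IsBlockIdempotent e}
  {φ : Subalgebra.center O O[G] →ₐ[O] ResidueField O}

/-- The central character of a real block is fixed by `σ`: otherwise `z ^ σ - a`, with `a` a lift of
`φ z`, is invertible in the block, and then so is its image `z - a`, on which `φ` vanishes. -/
theorem IsCentralCharacter.sigma_eq (hφ : IsCentralCharacter he φ) (hr : IsReal e)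
    (z : Subalgebra.center O O[G]) : φ ⟨wreathRep O G sigma z, sigma_mem_center z.2⟩ = φ z := by
  obtain ⟨a, ha⟩ := residue_surjective (φ z)
  have hφa : φ (algebraMap O _ a) = residue O a := by rw [AlgHom.commutes]; rfl
  set y : Subalgebra.center O O[G] := ⟨wreathRep O G sigma z, sigma_mem_center z.2⟩
  by_contra hne
  have h1 : φ (y - algebraMap O _ a) ≠ 0 := by
    rwa [map_sub, hφa, ha, sub_ne_zero]
  obtain ⟨b, hb⟩ := hφ.exists_mul_eq _ h1
  have hy : wreathRep O G sigma (y - algebraMap O O[G] a) = z - algebraMap O O[G] a := by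
    rw [map_sub, sigma_sigma, MonoidAlgebra.coe_algebraMap]
    simp [wreathRep_single, sigma_smul]
  have h2 : (⟨wreathRep O G sigma b, sigma_mem_center b.2⟩ : Subalgebra.center O O[G]) *
      (z - algebraMap O _ a) = ⟨e, he.central⟩ := by
    refine Subtype.ext ?_
    have h3 : (y - algebraMap O O[G] a) * b = e := congrArg Subtype.val hb
    change wreathRep O G sigma b * (z - algebraMap O O[G] a) = e
    rw [← hy, ← sigma_mul, h3, (isReal_iff he).mp hr]
  have h4 := congrArg φ h2
  rw [map_mul, map_sub, hφa, ha, sub_self, mul_zero, hφ.map_idem] at h4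
  exact zero_ne_one h4

/-- An element that is fixed by `σ` and invertible in the block has an inverse on `B + B°` that is
fixed by `σ`. -/
theorem IsCentralCharacter.exists_sigma_fixed (hφ : IsCentralCharacter he φ)
    {z : Subalgebra.center O O[G]} (hs : wreathRep O G sigma z = (z : O[G])) (hz : φ z ≠ 0) :
    ∃ b ∈ Subalgebra.center O O[G], wreathRep O G sigma b = b ∧ z * b = hull e := by
  obtain ⟨b, hb⟩ := hφ.exists_mul_eq z hz
  have hb1 : (z : O[G]) * b = e := congrArg Subtype.val hb
  have hb2 : (z : O[G]) * wreathRep O G sigma b = wreathRep O G sigma e := by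
    conv_lhs => rw [← hs]
    rw [← sigma_mul, ← Subalgebra.mem_center_iff.mp b.2, hb1]
  by_cases hr : IsReal e
  · have hse := (isReal_iff he).mp hr
    rw [hse] at hb2
    have hec := Subalgebra.mem_center_iff.mp he.central
    have hbc := Subalgebra.mem_center_iff.mp b.2
    refine ⟨b * e, mul_mem b.2 he.central, ?_, ?_⟩
    · rw [sigma_mul, hse]
      calc e * wreathRep O G sigma b = z * b * wreathRep O G sigma b := by rw [hb1]
        _ = b * (z * wreathRep O G sigma b) := by
          rw [← mul_assoc, hbc z]
        _ = b * e := by rw [hb2]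
    · rw [hull_of_isReal hr, ← mul_assoc, hb1, he.idem.eq]
  · refine ⟨b + wreathRep O G sigma b, add_mem b.2 (sigma_mem_center b.2), ?_, ?_⟩
    · rw [map_add, sigma_sigma, add_comm]
    · rw [mul_add, hb1, hb2, hull_of_not_isReal hr]

/-- If `c` is conjugate to `c⁻¹`, then its coefficients in `e` and in `e ^ σ` agree and add up to
zero in characteristic `2`. -/
theorem not_isConj_inv_of_coeff_hull [CharP (ResidueField O) 2]
    (he : IsBlockIdempotent e) (hr : ¬ IsReal e) {c : G}
    (hc : residue O ((hull e).coeff c) ≠ 0) : ¬ IsConj c c⁻¹ := by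
  intro h
  refine hc ?_
  rw [hull_of_not_isReal hr, MonoidAlgebra.coeff_add, Finsupp.add_apply, coeff_sigma,
    ← coeff_eq_of_isConj he.central h, map_add, CharTwo.add_self_eq_zero]

variable [Finite G]

theorem IsCentralCharacter.exists_realClassSum_ne_zero (hφ : IsCentralCharacter he φ) :
    ∃ c, residue O ((hull e).coeff c) ≠ 0 ∧ φ (realClassSum O c) ≠ 0 := by
  refine exists_coeff_ne_zero φ (wreathSetoid G)
    (fun c d h => wreathSetoid_iff.mpr (.inl h)) ⟨hull e, hull_mem_center he⟩
    (fun c d h => coeff_eq_of_wreathSetoid (hull_mem_center he) (sigma_hull he) h) ?_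
  intro h
  have h1 : (⟨e, he.central⟩ * ⟨hull e, hull_mem_center he⟩ : Subalgebra.center O O[G]) =
      ⟨e, he.central⟩ := Subtype.ext (mul_hull he)
  have h2 := congrArg φ h1
  rw [map_mul, h, mul_zero, hφ.map_idem] at h2
  exact zero_ne_one h2

variable [CharP (ResidueField O) 2]

/-- If `c` is not conjugate to `c⁻¹`, then the central character of a real block takes the same
value on both class sums, and these values add up to zero in characteristic `2`. -/
theorem IsCentralCharacter.isConj_inv (hφ : IsCentralCharacter he φ) (hr : IsReal e) {c : G}
    (hc : φ (realClassSum O c) ≠ 0) : IsConj c c⁻¹ := by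
  by_contra h
  refine hc ?_
  have h1 : classSum O c⁻¹ =
      ⟨wreathRep O G sigma (classSum O c), sigma_mem_center (classSum O c).2⟩ :=
    Subtype.ext (sigma_classSum c).symm
  rw [realClassSum_of_not_isConj h, map_add, h1, hφ.sigma_eq hr, CharTwo.add_self_eq_zero]

end Character

/-! ### Sylow subgroups of the stabilizers in the wreath product -/

section Stabilizer

variable {G : Type*} [Group G]

theorem centralizer_inv (c : G) :
    Subgroup.centralizer {c⁻¹} = Subgroup.centralizer {c} := by
  ext g
  rw [Subgroup.mem_centralizer_singleton_iff, Subgroup.mem_centralizer_singleton_iff]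
  exact Commute.inv_right_iff (a := g) (b := c)

theorem diag_injective : Function.Injective (diag : G → Wreath G) := by
  intro g h hgh
  have := congrArg (fun w : Wreath G => w.left.1) hgh
  exact this

theorem diag_mul_sigma (g : G) : (diag g * sigma : Wreath G) = sigma * diag g :=
  inl_mul_sigma g g

theorem sigma_mul_sigma : (sigma * sigma : Wreath G) = 1 := by
  have h2 : sgen * sgen = 1 := by decide
  rw [sigma, ← map_mul, h2, map_one]

theorem mem_sigmaSubgroup {w : Wreath G} : w ∈ SigmaSubgroup G ↔ w = 1 ∨ w = sigma := by
  have h2 : (sigma : Wreath G) ^ (2 : ℤ) = 1 := by rw [zpow_two, sigma_mul_sigma]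
  constructor
  · rintro ⟨n, rfl⟩
    obtain ⟨m, rfl | rfl⟩ := Int.even_or_odd' n
    · left
      exact (zpow_mul _ _ _).trans (by rw [h2, one_zpow])
    · right
      exact (zpow_add_one _ _).trans (by rw [zpow_mul, h2, one_zpow, one_mul])
  · rintro (rfl | rfl)
    · exact one_mem _
    · exact Subgroup.mem_zpowers _

theorem diag_right (g : G) : (diag g).right = 1 := rfl

theorem diag_mul_sigma_right (g : G) : (diag g * sigma).right = sgen := by
  rw [SemidirectProduct.mul_right, diag_right, one_mul]
  rfl

theorem eq_diag_of_smul_one {w : Wreath G} (hw : w • (1 : G) = 1) :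
    (∃ g, w = diag g) ∨ ∃ g, w = diag g * sigma := by
  rcases wreath_cases w with ⟨a, b, rfl⟩ | ⟨a, b, rfl⟩
  · rw [inl_smul] at hw
    have : a = b := by simpa [mul_inv_eq_one] using hw
    subst this
    exact .inl ⟨a, rfl⟩
  · rw [mul_smul, sigma_smul, inl_smul] at hw
    have : a = b := by simpa [mul_inv_eq_one] using hw
    subst this
    exact .inr ⟨a, rfl⟩

theorem diag_mem_stabilizer {g c : G} :
    diag g ∈ MulAction.stabilizer (Wreath G) ((1, c) : G × G) ↔ g ∈ Subgroup.centralizer {c} := by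
  rw [MulAction.mem_stabilizer_iff, Prod.smul_mk, diag_smul, diag_smul,
    Subgroup.mem_centralizer_singleton_iff, Prod.mk_inj, mul_one, mul_inv_cancel,
    mul_inv_eq_iff_eq_mul]
  exact and_iff_right rfl

theorem diag_mul_sigma_mem_stabilizer {g c : G} :
    diag g * sigma ∈ MulAction.stabilizer (Wreath G) ((1, c) : G × G) ↔ g * c⁻¹ * g⁻¹ = c := by
  rw [MulAction.mem_stabilizer_iff, Prod.smul_mk, mul_smul, mul_smul, sigma_smul, sigma_smul,
    diag_smul, diag_smul, Prod.mk_inj, inv_one, mul_one, mul_inv_cancel]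
  exact and_iff_right rfl

theorem eq_diag_of_mem_stabilizer {c : G} {w : Wreath G}
    (hw : w ∈ MulAction.stabilizer (Wreath G) ((1, c) : G × G)) :
    (∃ g, w = diag g) ∨ ∃ g, w = diag g * sigma :=
  eq_diag_of_smul_one (congrArg Prod.fst hw)

theorem stabilizer_eq_map_of_not_isConj {c : G} (hc : ¬ IsConj c c⁻¹) :
    MulAction.stabilizer (Wreath G) ((1, c) : G × G) = (Subgroup.centralizer {c}).map diag := by
  ext w
  constructor
  · intro hw
    rcases eq_diag_of_mem_stabilizer hw with ⟨g, rfl⟩ | ⟨g, rfl⟩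
    · exact ⟨g, diag_mem_stabilizer.mp hw, rfl⟩
    · exact absurd (IsConj.symm (isConj_iff.mpr ⟨g, diag_mul_sigma_mem_stabilizer.mp hw⟩)) hc
  · rintro ⟨g, hg, rfl⟩
    exact diag_mem_stabilizer.mpr hg

/-- A subgroup of `H` of odd index that is a `2`-group is maximal among the `2`-subgroups of
`H`. -/
theorem eq_of_isPGroup_of_odd_relIndex {Γ : Type*} [Group Γ] [Finite Γ] {D E H : Subgroup Γ}
    (hDE : D ≤ E) (hEH : E ≤ H) (hE : IsPGroup 2 E) (hD : ¬ 2 ∣ D.relIndex H) : E = D := by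
  refine le_antisymm (Subgroup.relIndex_eq_one.mp ?_) hDE
  have h1 : D.relIndex E ∣ D.relIndex H :=
    ⟨_, (Subgroup.relIndex_mul_relIndex D E H hDE hEH).symm⟩
  obtain ⟨n, hn⟩ := hE.index (D.subgroupOf E)
  change D.relIndex E = 2 ^ n at hn
  rcases n with _ | n
  · simpa using hn
  · exact absurd ((hn ▸ dvd_pow_self 2 n.succ_ne_zero : 2 ∣ D.relIndex E).trans h1) hD

/-- If the conjugacy class of `c` is real, then every subgroup `D` of odd index in the centralizer
of `c` that is a `2`-group extends by an element that inverts `c` to a Sylow `2`-subgroup of the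
stabilizer of `(1, c)`. -/
theorem exists_sylow_stabilizer [Finite G] {c : G} (hc : IsConj c c⁻¹) {D : Subgroup G}
    (hD : D ≤ Subgroup.centralizer {c}) (hD2 : IsPGroup 2 D)
    (hodd : ¬ 2 ∣ D.relIndex (Subgroup.centralizer {c})) :
    ∃ x ∈ Subgroup.normalizer (D : Set G), x ^ 2 ∈ D ∧
      D.map diag ⊔ Subgroup.zpowers (diag x * sigma) ≤
        MulAction.stabilizer (Wreath G) ((1, c) : G × G) ∧
      IsPGroup 2 (D.map diag ⊔ Subgroup.zpowers (diag x * sigma) : Subgroup (Wreath G)) ∧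
      ¬ 2 ∣ (D.map diag ⊔ Subgroup.zpowers (diag x * sigma)).relIndex
        (MulAction.stabilizer (Wreath G) ((1, c) : G × G)) := by
  set S := MulAction.stabilizer (Wreath G) ((1, c) : G × G) with hS
  have hDS : D.map diag ≤ S := by
    rintro _ ⟨d, hd, rfl⟩
    exact diag_mem_stabilizer.mpr (hD hd)
  have hP : IsPGroup 2 ((D.map diag).subgroupOf S) :=
    (hD2.map diag).comap_of_injective S.subtype S.subtype_injective
  obtain ⟨Q, hQ⟩ := hP.exists_le_sylow
  set V : Subgroup (Wreath G) := (Q : Subgroup S).map S.subtype with hV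
  have hVS : V ≤ S := Subgroup.map_subtype_le _
  have hV2 : IsPGroup 2 V := Q.2.map S.subtype
  have hVi : ¬ 2 ∣ V.relIndex S := by
    rw [Subgroup.relIndex, hV, Subgroup.subgroupOf, Subgroup.comap_map_eq_self_of_injective
      S.subtype_injective]
    exact Q.not_dvd_index
  have hDV : D.map diag ≤ V := by
    rw [hV, ← Subgroup.map_subgroupOf_eq_of_le hDS]
    exact Subgroup.map_mono hQ
  have hcomap : V.comap diag = D := by
    refine eq_of_isPGroup_of_odd_relIndex (H := Subgroup.centralizer {c})
      (Subgroup.map_le_iff_le_comap.mp hDV) ?_ (hV2.comap_of_injective _ diag_injective) hodd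
    intro g hg
    exact diag_mem_stabilizer.mp (hVS hg)
  have hmem : ∀ {g : G}, diag g ∈ V ↔ g ∈ D := fun {g} => by rw [← hcomap]; rfl
  obtain ⟨x, hx⟩ : ∃ x, diag x * sigma ∈ V := by
    -- Otherwise `V` lies in the kernel of the projection to the group of order two, which has even
    -- index in the stabilizer.
    by_contra! hno
    obtain ⟨g, hg⟩ := isConj_iff.mp hc.symm
    let π : S →* Sigma2 := SemidirectProduct.rightHom.comp S.subtype
    have hle : (Q : Subgroup S) ≤ π.ker := by
      intro w hw
      rcases eq_diag_of_mem_stabilizer w.2 with ⟨h, hh⟩ | ⟨h, hh⟩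
      · change w.1.right = 1
        rw [hh, diag_right]
      · exact absurd ⟨w, hw, hh⟩ (hno h)
    have hsurj : Function.Surjective π := by
      intro s
      have key : ∀ u : Sigma2, u = 1 ∨ u = sgen := by decide
      rcases key s with rfl | rfl
      · exact ⟨1, map_one _⟩
      · exact ⟨⟨diag g * sigma, diag_mul_sigma_mem_stabilizer.mpr hg⟩, diag_mul_sigma_right g⟩
    have h2 : π.ker.index = 2 := by
      rw [Subgroup.index_ker, MonoidHom.range_eq_top.mpr hsurj, Subgroup.card_top,
        Nat.card_eq_fintype_card,
        Fintype.card_multiplicative, ZMod.card]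
    exact Q.not_dvd_index (h2.symm.dvd.trans (Subgroup.index_dvd_of_le hle))
  have hconj : ∀ d ∈ D, x * d * x⁻¹ ∈ D := by
    intro d hd
    rw [← hmem]
    have := V.mul_mem (V.mul_mem hx (hmem.mpr hd)) (V.inv_mem hx)
    convert this using 1
    rw [mul_inv_rev, map_mul, map_mul, map_inv, mul_assoc (diag x) sigma, ← diag_mul_sigma d]
    group
  have hsq : x ^ 2 ∈ D := by
    rw [← hmem]
    have := V.mul_mem hx hx
    convert this using 1
    rw [mul_assoc, ← mul_assoc sigma, ← diag_mul_sigma, mul_assoc, sigma_mul_sigma, mul_one,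
      map_pow, sq]
  have heq : D.map diag ⊔ Subgroup.zpowers (diag x * sigma) = V := by
    refine le_antisymm (sup_le hDV (by simpa using hx)) ?_
    intro w hw
    rcases eq_diag_of_mem_stabilizer (hVS hw) with ⟨g, rfl⟩ | ⟨g, rfl⟩
    · exact Subgroup.mem_sup_left ⟨g, hmem.mp hw, rfl⟩
    · have h1 : g * x⁻¹ ∈ D := by
        rw [← hmem]
        have := V.mul_mem hw (V.inv_mem hx)
        convert this using 1
        rw [map_mul, map_inv]
        group
      have h2 : diag g * sigma = diag (g * x⁻¹) * (diag x * sigma) := by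
        rw [map_mul, map_inv]
        group
      rw [h2]
      exact mul_mem (Subgroup.mem_sup_left ⟨_, h1, rfl⟩)
        (Subgroup.mem_sup_right (Subgroup.mem_zpowers _))
  refine ⟨x, ?_, hsq, by rwa [heq], by rwa [heq], by rwa [heq]⟩
  rw [Subgroup.mem_normalizer_iff_map_conj_eq]
  refine Subgroup.eq_of_le_of_card_ge ?_ ?_
  · rintro _ ⟨d, hd, rfl⟩
    exact hconj d hd
  · exact (Subgroup.card_map_of_injective (MulAut.conj x).injective).ge

end Stabilizer

/-! ### Vertices of `B + B°` -/

section Vertex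

theorem le_of_conj_le {Γ : Type*} [Group Γ] [Finite Γ] {V H : Subgroup Γ} (hHV : H ≤ V) {w : Γ}
    (hw : ∀ x ∈ V, w⁻¹ * x * w ∈ H) : V ≤ H := by
  refine (Subgroup.eq_of_le_of_card_ge hHV ?_).ge
  refine Nat.card_le_card_of_injective (fun x : V => (⟨w⁻¹ * x * w, hw x x.2⟩ : H)) ?_
  intro x y hxy
  have := congrArg Subtype.val hxy
  exact Subtype.ext (by simpa using this)

variable {O G : Type*} [CommRing O] [IsLocalRing O] [CharP (ResidueField O) 2] [Group G]
  [Finite G] {e : O[G]} {he : IsBlockIdempotent e}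
  {φ : Subalgebra.center O O[G] →ₐ[O] ResidueField O}

/-- The conjugates of a Sylow `2`-subgroup of the stabilizer of `(1, c)` are vertices of `B + B°`
if `c` occurs in the idempotent of `B + B°` and the central character of `B` does not vanish on the
corresponding sum. -/
theorem isVertex_map_conj (hφ : IsCentralCharacter he φ) {c : G}
    (hc : residue O ((hull e).coeff c) ≠ 0) (hcφ : φ (realClassSum O c) ≠ 0)
    {V : Subgroup (Wreath G)} (hV : V ≤ MulAction.stabilizer (Wreath G) ((1, c) : G × G))
    (hV2 : IsPGroup 2 V)
    (hodd : ¬ 2 ∣ V.relIndex (MulAction.stabilizer (Wreath G) ((1, c) : G × G)))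
    (w : Wreath G) :
    IsVertex (blockSumRep he) (V.map (MulAut.conj w).toMonoidHom) := by
  obtain ⟨b, hb, hbs, hcb⟩ := hφ.exists_sigma_fixed (sigma_realClassSum c) hcφ
  have hst : MulAction.stabilizer (Wreath G) (w • ((1, c) : G × G)) =
      (MulAction.stabilizer (Wreath G) ((1, c) : G × G)).map (MulAut.conj w).toMonoidHom :=
    MulAction.stabilizer_smul_eq_stabilizer_map_conj _ _
  refine ⟨blockSumRep_isIndecomposable he, ?_, ?_⟩
  · refine isRelProjective_blockSumRep he c (p := w • (1, c)) (MulAction.mem_orbit _ _) ?_ ?_ hb hbs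
      hcb
    · rw [hst]
      exact Subgroup.map_mono hV
    · rw [hst, Subgroup.relIndex_map_map_of_injective _ _ (MulAut.conj w).injective]
      exact isUnit_natCast_of_odd hodd
  · intro H hH hle
    obtain ⟨v, hv⟩ := exists_conj_mem_of_isRelProjective he hH hc hV hV2
    refine le_of_conj_le hle (w := w * v) ?_
    rintro _ ⟨x, hx, rfl⟩
    have := hv x hx
    convert this using 1
    simp only [MulEquiv.coe_toMonoidHom, MulAut.conj_apply]
    group

theorem isVertex_of_sylow (hφ : IsCentralCharacter he φ) {c : G}
    (hc : residue O ((hull e).coeff c) ≠ 0) (hcφ : φ (realClassSum O c) ≠ 0)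
    {V : Subgroup (Wreath G)} (hV : V ≤ MulAction.stabilizer (Wreath G) ((1, c) : G × G))
    (hV2 : IsPGroup 2 V)
    (hodd : ¬ 2 ∣ V.relIndex (MulAction.stabilizer (Wreath G) ((1, c) : G × G))) :
    IsVertex (blockSumRep he) V := by
  have := isVertex_map_conj hφ hc hcφ hV hV2 hodd 1
  rw [map_one] at this
  convert this
  exact (Subgroup.map_id V).symm

/-- A defect group of a block is a Sylow `2`-subgroup of the centralizer of an element `c` that
occurs in the idempotent of `B + B°`, such that the central character of `B` does not vanish on the
sum of the conjugates of `c` and of `c⁻¹`. -/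
theorem exists_sylow_centralizer (hφ : IsCentralCharacter he φ) {D : Subgroup G}
    (hD : IsDefectGroup e D) :
    ∃ c, residue O ((hull e).coeff c) ≠ 0 ∧ φ (realClassSum O c) ≠ 0 ∧
      D ≤ Subgroup.centralizer {c} ∧ IsPGroup 2 D ∧
      ¬ 2 ∣ D.relIndex (Subgroup.centralizer {c}) := by
  obtain ⟨c, hc, hcφ⟩ := hφ.exists_realClassSum_ne_zero
  -- In the support of the idempotent and of the central character, `c` may be replaced by `c⁻¹`:
  -- both have the same centralizer.
  obtain ⟨c₁, h₁, hc₁⟩ : ∃ c₁, (c₁ = c ∨ c₁ = c⁻¹) ∧ residue O (e.coeff c₁) ≠ 0 := by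
    by_cases hr : IsReal e
    · exact ⟨c, .inl rfl, by rwa [hull_of_isReal hr] at hc⟩
    · rw [hull_of_not_isReal hr, MonoidAlgebra.coeff_add, Finsupp.add_apply, coeff_sigma,
        map_add] at hc
      by_cases h : residue O (e.coeff c) = 0
      · exact ⟨c⁻¹, .inr rfl, by rwa [h, zero_add] at hc⟩
      · exact ⟨c, .inl rfl, h⟩
  obtain ⟨c₂, h₂, hc₂⟩ : ∃ c₂, (c₂ = c ∨ c₂ = c⁻¹) ∧ φ (classSum O c₂) ≠ 0 := by
    by_cases hr : IsConj c c⁻¹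
    · exact ⟨c, .inl rfl, by rwa [realClassSum_of_isConj hr] at hcφ⟩
    · rw [realClassSum_of_not_isConj hr, map_add] at hcφ
      by_cases h : φ (classSum O c) = 0
      · exact ⟨c⁻¹, .inr rfl, by rwa [h, zero_add] at hcφ⟩
      · exact ⟨c, .inl rfl, h⟩
  have hcent : ∀ d, (d = c ∨ d = c⁻¹) → Subgroup.centralizer {d} = Subgroup.centralizer {c} := by
    rintro d (rfl | rfl)
    · rfl
    · exact centralizer_inv c
  obtain ⟨Q⟩ : Nonempty (Sylow 2 (Subgroup.centralizer {c})) := inferInstance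
  set P : Subgroup G := (Q : Subgroup (Subgroup.centralizer {c})).map
    (Subgroup.centralizer {c}).subtype with hP
  have hPc : P ≤ Subgroup.centralizer {c} := Subgroup.map_subtype_le _
  have hP2 : IsPGroup 2 P := Q.2.map _
  have hPi : ¬ 2 ∣ P.relIndex (Subgroup.centralizer {c}) := by
    rw [Subgroup.relIndex, hP, Subgroup.subgroupOf, Subgroup.comap_map_eq_self_of_injective
      (Subgroup.subtype_injective _)]
    exact Q.not_dvd_index
  obtain ⟨g, hg⟩ := exists_conj_mem_of_isTraceFrom hD.1 hc₁ (hPc.trans (hcent c₁ h₁).ge) hP2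
  have hcg : ∀ d, (Subgroup.centralizer {g⁻¹ * d * g} : Subgroup G) =
      (Subgroup.centralizer {d}).map (MulAut.conj g⁻¹).toMonoidHom := by
    intro d
    ext x
    simp only [Subgroup.mem_map, Subgroup.mem_centralizer_singleton_iff,
      MulEquiv.coe_toMonoidHom, MulAut.conj_apply, inv_inv]
    constructor
    · intro hx
      refine ⟨g * x * g⁻¹, ?_, by group⟩
      have := congrArg (fun y => g * y * g⁻¹) hx
      simpa [mul_assoc] using this
    · rintro ⟨y, hy, rfl⟩
      have := congrArg (fun y => g⁻¹ * y * g) hy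
      simpa [mul_assoc] using this
  have hinj := (MulAut.conj g⁻¹).injective
  have hV : P.map (MulAut.conj g⁻¹).toMonoidHom = D := by
    have hle : P.map (MulAut.conj g⁻¹).toMonoidHom ≤ D := by
      rintro _ ⟨x, hx, rfl⟩
      simpa using hg x hx
    -- The conjugate of `P` that lies in `D` is itself a subgroup from which `e` is a trace.
    refine le_antisymm hle (hD.2 ?_ hle)
    obtain ⟨b, hb⟩ := hφ.exists_mul_eq _ hc₂
    have hconj : IsConj c₂ (g⁻¹ * c₂ * g) := isConj_iff.mpr ⟨g⁻¹, by rw [inv_inv]⟩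
    refine isTraceFrom_of_classSum_mul (g⁻¹ * c₂ * g) ?_ ?_ b.2 ?_
    · rw [hcg, hcent c₂ h₂]
      exact Subgroup.map_mono hPc
    · rw [hcg, hcent c₂ h₂, Subgroup.relIndex_map_map_of_injective _ _ hinj]
      exact isUnit_natCast_of_odd hPi
    · rw [← classSum_eq_of_isConj hconj]
      exact congrArg Subtype.val hb
  have hconj : IsConj c (g⁻¹ * c * g) := isConj_iff.mpr ⟨g⁻¹, by rw [inv_inv]⟩
  refine ⟨g⁻¹ * c * g, ?_, ?_, ?_, ?_, ?_⟩
  · rwa [← coeff_eq_of_isConj (hull_mem_center he) hconj]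
  · rwa [← realClassSum_eq_of_isConj hconj]
  · rw [hcg, ← hV]
    exact Subgroup.map_mono hPc
  · rw [← hV]
    exact hP2.map _
  · rw [hcg, ← hV, Subgroup.relIndex_map_map_of_injective _ _ hinj]
    exact hPi

/-- If `B` is not real, then `c` is not conjugate to `c⁻¹`, and the stabilizer of `(1, c)` is the
diagonal copy of the centralizer of `c`. -/
theorem isVertex_of_not_isReal (hφ : IsCentralCharacter he φ) {D : Subgroup G}
    (hD : IsDefectGroup e D) (hr : ¬ IsReal e) :
    IsVertex (blockSumRep he) (D.map diag) := by
  obtain ⟨c, hc, hcφ, hDc, hD2, hodd⟩ := exists_sylow_centralizer hφ hD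
  have hst := stabilizer_eq_map_of_not_isConj (not_isConj_inv_of_coeff_hull he hr hc)
  refine isVertex_of_sylow hφ hc hcφ ?_ (hD2.map _) ?_
  · rw [hst]
    exact Subgroup.map_mono hDc
  · rwa [hst, Subgroup.relIndex_map_map_of_injective _ _ diag_injective]

/-- All conjugates of the vertex are included in the statement, since vertices are only determined
up to conjugation. -/
theorem exists_isVertex_of_isReal (hφ : IsCentralCharacter he φ) {D : Subgroup G}
    (hD : IsDefectGroup e D) (hr : IsReal e) :
    ∃ x ∈ Subgroup.normalizer (D : Set G), x ^ 2 ∈ D ∧ ∀ w : Wreath G,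
      IsVertex (blockSumRep he)
        ((D.map diag ⊔ Subgroup.zpowers (diag x * sigma)).map (MulAut.conj w).toMonoidHom) := by
  obtain ⟨c, hc, hcφ, hDc, hD2, hodd⟩ := exists_sylow_centralizer hφ hD
  obtain ⟨x, hx, hx2, hV, hV2, hVi⟩ :=
    exists_sylow_stabilizer (hφ.isConj_inv hr hcφ) hDc hD2 hodd
  exact ⟨x, hx, hx2, isVertex_map_conj hφ hc hcφ hV hV2 hVi⟩

/-- A conjugate of the diagonal copy of a defect group is contained in `Σ`, and it is contained in
the base group, which meets `Σ` trivially. -/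
theorem defectGroup_eq_bot_of_isRelProjective (hφ : IsCentralCharacter he φ) {D : Subgroup G}
    (hD : IsDefectGroup e D) (hS : IsRelProjective (blockSumRep he) (SigmaSubgroup G)) :
    D = ⊥ := by
  obtain ⟨c, hc, hcφ, hDc, hD2, hodd⟩ := exists_sylow_centralizer hφ hD
  have hle : D.map diag ≤ MulAction.stabilizer (Wreath G) ((1, c) : G × G) := by
    rintro _ ⟨d, hd, rfl⟩
    exact diag_mem_stabilizer.mpr (hDc hd)
  obtain ⟨w, hw⟩ := exists_conj_mem_of_isRelProjective he hS hc hle (hD2.map _)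
  refine (Subgroup.eq_bot_iff_forall D).mpr fun d hd => ?_
  have h1 := hw (diag d) ⟨d, hd, rfl⟩
  rcases mem_sigmaSubgroup.mp h1 with h | h
  · refine diag_injective ?_
    rw [map_one]
    have := congrArg (fun y => w * y * w⁻¹) h
    simpa [mul_assoc] using this
  · have := congrArg SemidirectProduct.rightHom h
    rw [map_mul, map_mul, map_inv, mul_comm, mul_inv_cancel_left] at this
    exact absurd this (by decide : (1 : Sigma2) ≠ sgen)

/-- If the defect group is trivial, the vertex is generated by the involution `diag x * σ`, which is
conjugate to `σ` by `(x, 1)`. -/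
theorem isVertex_sigma_of_eq_bot (hφ : IsCentralCharacter he φ) (hD : IsDefectGroup e ⊥)
    (hr : IsReal e) : IsVertex (blockSumRep he) (SigmaSubgroup G) := by
  obtain ⟨x, -, hx2, hV⟩ := exists_isVertex_of_isReal hφ hD hr
  have hxx : x * x = 1 := by rw [← sq]; exact Subgroup.mem_bot.mp hx2
  have := hV (SemidirectProduct.inl (x, 1))
  rw [Subgroup.map_bot, bot_sup_eq, MonoidHom.map_zpowers] at this
  convert this using 2
  change Subgroup.zpowers sigma = Subgroup.zpowers
    (SemidirectProduct.inl (x, 1) * (diag x * sigma) * (SemidirectProduct.inl (x, 1))⁻¹)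
  congr 1
  rw [← map_inv, mul_assoc, mul_assoc]
  have h1 : (sigma * SemidirectProduct.inl (x, 1)⁻¹ : Wreath G) =
      SemidirectProduct.inl (1, x⁻¹) * sigma := by
    rw [inl_mul_sigma, Prod.inv_mk, inv_one]
  have h2 : (SemidirectProduct.inl (x, 1) * (diag x * SemidirectProduct.inl (1, x⁻¹)) :
      Wreath G) = 1 := by
    change (SemidirectProduct.inl (x, 1) * (SemidirectProduct.inl (x, x) *
      SemidirectProduct.inl (1, x⁻¹)) : Wreath G) = 1
    rw [← map_mul, ← map_mul]
    rw [Prod.mk_mul_mk, Prod.mk_mul_mk, one_mul, mul_one, mul_inv_cancel, hxx]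
    exact map_one _
  rw [h1, ← mul_assoc (diag x), ← mul_assoc, h2, one_mul]

theorem not_isVertex_sigma_of_not_isReal (hφ : IsCentralCharacter he φ) {D : Subgroup G}
    (hD : IsDefectGroup e D) (hr : ¬ IsReal e) :
    ¬ IsVertex (blockSumRep he) (SigmaSubgroup G) := by
  intro hS
  have hbot := defectGroup_eq_bot_of_isRelProjective hφ hD hS.minimal.1
  have h1 := isVertex_of_not_isReal hφ hD hr
  rw [hbot, Subgroup.map_bot] at h1
  have h2 : (sigma : Wreath G) ∈ (⊥ : Subgroup (Wreath G)) :=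
    hS.minimal.2 h1.minimal.1 bot_le (Subgroup.mem_zpowers sigma)
  have h3 := congrArg SemidirectProduct.rightHom (Subgroup.mem_bot.mp h2)
  exact absurd h3 (by decide : sgen ≠ 1)

end Vertex

/-! ### Blocks that are traces from the trivial subgroup -/

section TraceIdeal

theorem linearMap_ext_of_single {k G M : Type*} [Field k] [AddCommMonoid M] [Module k M]
    {f g : k[G] →ₗ[k] M}
    (h : ∀ x, f (MonoidAlgebra.single x 1) = g (MonoidAlgebra.single x 1)) : f = g := by
  ext x
  simpa using h x

variable {k G : Type*} [Field k] [Group G] [Fintype G]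

/-- If the central idempotent `ε` is a trace from the trivial subgroup, then every two-sided ideal
`J` in the algebra of `ε` is generated by a central idempotent. This is the separability of the
algebra of `ε`: averaging a linear projection onto `J` over `G` makes it a bimodule map. -/
theorem exists_isIdempotentElem_of_sum_conj {ε a : k[G]}
    (hε : ε ∈ Subalgebra.center k k[G])
    (ha : ∑ g, MonoidAlgebra.of k G g * a * MonoidAlgebra.of k G g⁻¹ = ε) (J : Submodule k k[G])
    (hl : ∀ y, ∀ x ∈ J, y * x ∈ J) (hr : ∀ y, ∀ x ∈ J, x * y ∈ J) (hJ : ∀ x ∈ J, ε * x = x) :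
    ∃ f ∈ J, f ∈ Subalgebra.center k k[G] ∧ IsIdempotentElem f ∧ ∀ x ∈ J, f * x = x := by
  obtain ⟨J', hJ'⟩ := exists_isCompl J
  set π := J.projection J' hJ'
  have hπ : ∀ y, π y ∈ J := Submodule.projection_apply_mem hJ'
  have hπJ : ∀ x ∈ J, π x = x := fun x hx => (Submodule.projection_eq_self_iff hJ' x).mpr hx
  have hof : ∀ g h, MonoidAlgebra.of k G (g * h) =
      MonoidAlgebra.of k G g * MonoidAlgebra.of k G h :=
    map_mul _
  have hJ2 : ∀ x ∈ J, x * ε = x := fun x hx => by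
    rw [Subalgebra.mem_center_iff.mp hε, hJ x hx]
  -- Averaging `π` over `G` on either side gives multiplications by `f₁` and by `f₂` that fix `J`.
  set f₁ := ∑ g, MonoidAlgebra.of k G g * π (a * MonoidAlgebra.of k G g⁻¹) with hf₁
  set f₂ := ∑ g, π (MonoidAlgebra.of k G g * a) * MonoidAlgebra.of k G g⁻¹ with hf₂
  have h₁ : ∀ x ∈ J, x * f₁ = x := by
    intro x hx
    let T : k[G] →ₗ[k] k[G] := ∑ g, LinearMap.mulLeft k (MonoidAlgebra.of k G g) ∘ₗ π ∘ₗ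
      LinearMap.mulLeft k (a * MonoidAlgebra.of k G g⁻¹)
    have hT : ∀ y, T y = ∑ g, MonoidAlgebra.of k G g * π (a * MonoidAlgebra.of k G g⁻¹ * y) := by
      intro y
      simp only [T, LinearMap.sum_apply, LinearMap.comp_apply, LinearMap.mulLeft_apply]
    have hTm : T = LinearMap.mulRight k f₁ := by
      refine linearMap_ext_of_single fun h => ?_
      rw [hT, LinearMap.mulRight_apply, hf₁, Finset.mul_sum]
      refine Fintype.sum_equiv (Equiv.mulLeft h⁻¹) _ _ fun g => ?_
      rw [Equiv.coe_mulLeft, ← MonoidAlgebra.of_apply, ← mul_assoc, ← hof, mul_inv_cancel_left,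
        mul_inv_rev, inv_inv, hof, mul_assoc]
    calc x * f₁ = T x := by rw [hTm, LinearMap.mulRight_apply]
      _ = ∑ g, MonoidAlgebra.of k G g * a * MonoidAlgebra.of k G g⁻¹ * x := by
        rw [hT]
        refine Finset.sum_congr rfl fun g _ => ?_
        rw [hπJ _ (hl _ x hx)]
        simp only [mul_assoc]
      _ = x := by rw [← Finset.sum_mul, ha, hJ x hx]
  have h₂ : ∀ x ∈ J, f₂ * x = x := by
    intro x hx
    let T : k[G] →ₗ[k] k[G] := ∑ g, LinearMap.mulRight k (MonoidAlgebra.of k G g⁻¹) ∘ₗ π ∘ₗ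
      LinearMap.mulRight k (MonoidAlgebra.of k G g * a)
    have hT : ∀ y, T y = ∑ g, π (y * (MonoidAlgebra.of k G g * a)) * MonoidAlgebra.of k G g⁻¹ := by
      intro y
      simp only [T, LinearMap.sum_apply, LinearMap.comp_apply, LinearMap.mulRight_apply]
    have hTm : T = LinearMap.mulLeft k f₂ := by
      refine linearMap_ext_of_single fun h => ?_
      rw [hT, LinearMap.mulLeft_apply, hf₂, Finset.sum_mul]
      refine Fintype.sum_equiv (Equiv.mulLeft h) _ _ fun g => ?_
      rw [Equiv.coe_mulLeft, ← MonoidAlgebra.of_apply, ← mul_assoc, ← hof, mul_assoc, ← hof,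
        mul_inv_rev, inv_mul_cancel_right]
    calc f₂ * x = T x := by rw [hTm, LinearMap.mulLeft_apply]
      _ = ∑ g, x * (MonoidAlgebra.of k G g * a * MonoidAlgebra.of k G g⁻¹) := by
        rw [hT]
        refine Finset.sum_congr rfl fun g _ => ?_
        rw [hπJ _ (hr _ x hx)]
        simp only [mul_assoc]
      _ = x := by rw [← Finset.mul_sum, ha, hJ2 x hx]
  have hm₁ : f₁ ∈ J := Submodule.sum_mem _ fun g _ => hl _ _ (hπ _)
  have hm₂ : f₂ ∈ J := Submodule.sum_mem _ fun g _ => hr _ _ (hπ _)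
  have heq : f₁ = f₂ := by rw [← h₂ f₁ hm₁, h₁ f₂ hm₂]
  refine ⟨f₂, hm₂, ?_, h₂ f₂ hm₂, h₂⟩
  rw [Subalgebra.mem_center_iff]
  intro y
  calc y * f₂ = f₂ * (y * f₂) := (h₂ _ (hl y _ hm₂)).symm
    _ = f₂ * y * f₁ := by rw [heq, mul_assoc]
    _ = f₂ * y := h₁ _ (hr y _ hm₂)

/-- If the primitive central idempotent `ε` is a trace from the trivial subgroup, then its algebra
is simple. -/
theorem isSimpleRing_corner_of_sum_conj {ε a : k[G]} (hε : ε ∈ Subalgebra.center k k[G])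
    (hi : IsIdempotentElem ε) (hne : ε ≠ 0)
    (hprim : ∀ f ∈ Subalgebra.center k k[G], IsIdempotentElem f → ε * f = f → f = 0 ∨ f = ε)
    (ha : ∑ g, MonoidAlgebra.of k G g * a * MonoidAlgebra.of k G g⁻¹ = ε) :
    IsSimpleRing hi.Corner := by
  have hmem : ∀ x : k[G], x ∈ Subsemigroup.corner ε ↔ ε * x = x := fun x => by
    rw [Subsemigroup.mem_corner_iff hi, Subalgebra.mem_center_iff.mp hε, and_self]
  have hmul : ∀ x : k[G], ε * x ∈ Subsemigroup.corner ε := fun x => by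
    rw [hmem, ← mul_assoc, hi.eq]
  have : Nontrivial hi.Corner := ⟨⟨1, 0, fun h => hne (congrArg Subtype.val h)⟩⟩
  refine .of_eq_bot_or_eq_top fun I => ?_
  have hIl : ∀ y x : k[G], ∀ hx : x ∈ Subsemigroup.corner ε, (⟨x, hx⟩ : hi.Corner) ∈ I →
      ∃ hy : y * x ∈ Subsemigroup.corner ε, (⟨y * x, hy⟩ : hi.Corner) ∈ I := by
    intro y x hx hI
    have h1 : y * x = (ε * y) * x := by
      rw [← Subalgebra.mem_center_iff.mp hε, mul_assoc, (hmem x).mp hx]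
    have h2 : y * x ∈ Subsemigroup.corner ε := by rw [h1, mul_assoc]; exact hmul _
    refine ⟨h2, ?_⟩
    have h3 : (⟨y * x, h2⟩ : hi.Corner) = (⟨ε * y, hmul y⟩ : hi.Corner) * (⟨x, hx⟩ : hi.Corner) :=
      Subtype.ext h1
    exact h3 ▸ I.mul_mem_left _ _ hI
  have hIr : ∀ y x : k[G], ∀ hx : x ∈ Subsemigroup.corner ε, (⟨x, hx⟩ : hi.Corner) ∈ I →
      ∃ hy : x * y ∈ Subsemigroup.corner ε, (⟨x * y, hy⟩ : hi.Corner) ∈ I := by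
    intro y x hx hI
    have h1 : x * y = x * (ε * y) := by
      rw [← mul_assoc, Subalgebra.mem_center_iff.mp hε, (hmem x).mp hx]
    have h2 : x * y ∈ Subsemigroup.corner ε := by
      rw [← (hmem x).mp hx, mul_assoc]
      exact hmul _
    refine ⟨h2, ?_⟩
    have h3 : (⟨x * y, h2⟩ : hi.Corner) = (⟨x, hx⟩ : hi.Corner) * (⟨ε * y, hmul y⟩ : hi.Corner) :=
      Subtype.ext h1
    exact h3 ▸ I.mul_mem_right _ _ hI
  let J : Submodule k k[G] := {
    carrier := {x | ∃ hx : x ∈ Subsemigroup.corner ε, (⟨x, hx⟩ : hi.Corner) ∈ I}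
    add_mem' := by
      rintro x y ⟨hx, hxI⟩ ⟨hy, hyI⟩
      exact ⟨(hmem _).mpr (by rw [mul_add, (hmem x).mp hx, (hmem y).mp hy]), I.add_mem hxI hyI⟩
    zero_mem' := ⟨(hmem 0).mpr (mul_zero _), I.zero_mem⟩
    smul_mem' := by
      rintro c x ⟨hx, hxI⟩
      have := hIl (algebraMap k _ c) x hx hxI
      rwa [← Algebra.smul_def] at this }
  obtain ⟨f, ⟨hfc, hfI⟩, hf, hfi, hfJ⟩ := exists_isIdempotentElem_of_sum_conj hε ha J
    (fun y x hx => hIl y x hx.1 hx.2) (fun y x hx => hIr y x hx.1 hx.2)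
    (fun x hx => (hmem x).mp hx.1)
  rcases hprim f hf hfi ((hmem f).mp hfc) with rfl | rfl
  · left
    refine le_bot_iff.mp fun x hx => ?_
    have h1 : (0 : k[G]) * x.1 = x.1 := hfJ x.1 ⟨x.2, hx⟩
    rw [zero_mul] at h1
    exact Subtype.ext h1.symm
  · right
    exact (TwoSidedIdeal.one_mem_iff I).mp hfI

end TraceIdeal

/-! ### Simple direct factors of group algebras -/

/-- The Wedderburn theorem for a simple direct factor of a finite-dimensional algebra over an
algebraically closed field: the factor is the image of a surjection onto a matrix algebra whose
kernel is the complementary factor. -/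
theorem exists_algHom_matrix_of_isSimpleRing_corner {k A : Type*} [Field k] [IsAlgClosed k]
    [Ring A] [Algebra k A] [FiniteDimensional k A] {ε : A} (hε : ∀ x, Commute ε x)
    (hi : IsIdempotentElem ε) (hs : IsSimpleRing hi.Corner) :
    ∃ (n : ℕ) (_ : NeZero n) (Φ : A →ₐ[k] Matrix (Fin n) (Fin n) k),
      Function.Surjective Φ ∧ ∀ x, Φ x = 0 ↔ ε * x = 0 := by
  have hmem : ∀ x : A, x ∈ Subsemigroup.corner ε ↔ ε * x = x := fun x => by
    rw [Subsemigroup.mem_corner_iff hi, ← (hε x).eq, and_self]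
  have hmul : ∀ x : A, ε * x ∈ Subsemigroup.corner ε := fun x => by
    rw [hmem, ← mul_assoc, hi.eq]
  let p : A →+* hi.Corner := {
    toFun x := ⟨ε * x, hmul x⟩
    map_one' := Subtype.ext (mul_one ε)
    map_mul' x y := Subtype.ext (by
      change ε * (x * y) = ε * x * (ε * y)
      rw [(hε x).symm.mul_mul_mul_comm, hi.eq])
    map_zero' := Subtype.ext (mul_zero ε)
    map_add' x y := Subtype.ext (mul_add ε x y) }
  have hp : Function.Surjective p := fun x => ⟨x.1, Subtype.ext ((hmem x.1).mp x.2)⟩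
  let _ : Algebra k hi.Corner := RingHom.toAlgebra' (p.comp (algebraMap k A)) (by
    intro c x
    obtain ⟨x, rfl⟩ := hp x
    rw [RingHom.comp_apply, ← map_mul, ← map_mul, Algebra.commutes])
  let P : A →ₐ[k] hi.Corner := { p with commutes' := fun _ => rfl }
  have : FiniteDimensional k hi.Corner := Module.Finite.of_surjective P.toLinearMap hp
  obtain ⟨n, hn, ⟨ψ⟩⟩ := IsSimpleRing.exists_algEquiv_matrix_of_isAlgClosed k hi.Corner
  refine ⟨n, hn, ψ.toAlgHom.comp P, ψ.surjective.comp hp, fun x => ?_⟩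
  change ψ (P x) = 0 ↔ _
  rw [map_eq_zero_iff ψ ψ.injective]
  exact Subtype.ext_iff

section

variable {k G : Type*} [Field k] [Group G] [Fintype G]

/-- On a direct factor of a group algebra that is a matrix algebra, the trace from the trivial
subgroup does not vanish. -/
theorem exists_sum_conj_ne_zero {ε : k[G]} {n : ℕ} [NeZero n]
    (Φ : k[G] →ₐ[k] Matrix (Fin n) (Fin n) k) (hΦ : Function.Surjective Φ)
    (hε : ∀ x, Φ x = 0 ↔ ε * x = 0) (hi : IsIdempotentElem ε) :
    ∃ c : G, ∑ g : G, Φ (MonoidAlgebra.single (g * c * g⁻¹) 1) ≠ 0 := by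
  by_contra! H
  have h1 : ∀ X, ∑ g : G, Φ (MonoidAlgebra.of k G g) * X * Φ (MonoidAlgebra.of k G g⁻¹) = 0 := by
    intro X
    obtain ⟨y, rfl⟩ := hΦ X
    let T : k[G] →ₗ[k] Matrix (Fin n) (Fin n) k := ∑ g, LinearMap.mulRight k
      (Φ (MonoidAlgebra.of k G g⁻¹)) ∘ₗ LinearMap.mulLeft k (Φ (MonoidAlgebra.of k G g)) ∘ₗ
        Φ.toLinearMap
    have hT : ∀ y, T y = ∑ g : G, Φ (MonoidAlgebra.of k G g) * Φ y *
        Φ (MonoidAlgebra.of k G g⁻¹) := by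
      intro y
      simp only [T, LinearMap.sum_apply, LinearMap.comp_apply, LinearMap.mulLeft_apply,
        LinearMap.mulRight_apply, AlgHom.toLinearMap_apply]
    have h0 : T = 0 := by
      refine linearMap_ext_of_single fun c => ?_
      rw [hT, LinearMap.zero_apply, ← H c]
      refine Finset.sum_congr rfl fun g _ => ?_
      rw [← map_mul, ← map_mul]
      simp
    rw [← hT, h0, LinearMap.zero_apply]
  -- If all these sums vanish, expanding `ε` in group elements shows that its image `1` vanishes.
  obtain ⟨s, hs⟩ := Φ.toLinearMap.exists_rightInverse_of_surjective
    (LinearMap.range_eq_top.mpr hΦ)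
  have hs' : ∀ X, Φ (s X) = X := fun X => congrArg (fun f : _ →ₗ[k] _ => f X) hs
  -- The linear form on the matrix algebra that gives the coefficient of `1`.
  let l : Matrix (Fin n) (Fin n) k →ₗ[k] k :=
    Finsupp.lapply (1 : G) ∘ₗ (MonoidAlgebra.coeffLinearEquiv k).toLinearMap ∘ₗ
      LinearMap.mulLeft k ε ∘ₗ s
  have hl : ∀ y, l (Φ y) = (ε * y).coeff 1 := by
    intro y
    change (ε * s (Φ y)).coeff 1 = _
    have : ε * (s (Φ y) - y) = 0 := (hε _).mp (by rw [map_sub, hs', sub_self])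
    rw [mul_sub, sub_eq_zero] at this
    rw [this]
  have hone : Φ ε = 1 := by
    rw [← sub_eq_zero, ← map_one Φ, ← map_sub, hε, mul_sub, hi.eq, mul_one, sub_self]
  have hexp : ∑ g : G, l (Φ (MonoidAlgebra.of k G g⁻¹)) • Φ (MonoidAlgebra.of k G g) = 1 := by
    rw [← hone]
    have : ε = ∑ g : G, l (Φ (MonoidAlgebra.of k G g⁻¹)) • MonoidAlgebra.of k G g := by
      classical
      ext h
      rw [MonoidAlgebra.coeff_sum, Finsupp.finsetSum_apply, Finset.sum_eq_single h]
      · rw [hl]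
        simp
      · intro g _ hg
        simp [hg]
      · simp
    conv_rhs => rw [this, map_sum]
    simp only [map_smul]
  have h2 := congrArg (fun X : Matrix (Fin n) (Fin n) k => X 0 0) hexp
  simp only [Matrix.sum_apply, Matrix.smul_apply, smul_eq_mul, Matrix.one_apply_eq] at h2
  refine one_ne_zero (α := k) (h2.symm.trans ?_)
  have h3 : ∀ i j, ∑ g : G,
      Φ (MonoidAlgebra.of k G g) 0 0 * Φ (MonoidAlgebra.of k G g⁻¹) i j = 0 := by
    intro i j
    have := congrArg (fun X : Matrix (Fin n) (Fin n) k => X 0 j) (h1 (Matrix.single 0 i 1))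
    simpa [Matrix.sum_apply, Matrix.mul_apply, Matrix.single, Matrix.of_apply, ite_and,
      Finset.sum_ite_eq] using this
  have h4 : ∀ X : Matrix (Fin n) (Fin n) k, l X = ∑ i, ∑ j, X i j * l (Matrix.single i j 1) := by
    intro X
    conv_lhs => rw [Matrix.matrix_eq_sum_single X]
    simp only [map_sum]
    refine Finset.sum_congr rfl fun i _ => Finset.sum_congr rfl fun j _ => ?_
    rw [← smul_eq_mul, ← map_smul, Matrix.smul_single, smul_eq_mul, mul_one]
  rw [Finset.sum_congr rfl fun g _ => by rw [h4, Finset.sum_mul], Finset.sum_comm]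
  refine Finset.sum_eq_zero fun i _ => ?_
  rw [Finset.sum_congr rfl fun g _ => Finset.sum_mul _ _ _, Finset.sum_comm]
  refine Finset.sum_eq_zero fun j _ => ?_
  rw [← mul_zero (l (Matrix.single i j 1)), ← h3 i j, Finset.mul_sum]
  refine Finset.sum_congr rfl fun g _ => ?_
  ring

end

/-! ### Blocks of defect zero -/

section DefectZero

theorem sum_quotient_bot {G N : Type*} [Group G] [Fintype G] [AddCommMonoid N]
    [Fintype (G ⧸ (⊥ : Subgroup G))] (F : G → N) :
    ∑ q : G ⧸ (⊥ : Subgroup G), F q.out = ∑ g, F g := by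
  refine Fintype.sum_bijective (fun q : G ⧸ (⊥ : Subgroup G) => q.out)
    ⟨Quotient.out_injective, fun g => ?_⟩ _ _ fun _ => rfl
  obtain ⟨h, hh⟩ := QuotientGroup.mk_out_eq_mul (⊥ : Subgroup G) g
  exact ⟨(g : G ⧸ ⊥), hh.trans (by rw [Subgroup.mem_bot.mp h.2, mul_one])⟩

variable {O G : Type*} [CommRing O] [IsLocalRing O] [Group G]

theorem mapRingHom_mem_center {z : O[G]} (hz : z ∈ Subalgebra.center O O[G]) :
    MonoidAlgebra.mapRingHom G (residue O) z ∈
      Subalgebra.center (ResidueField O) (ResidueField O)[G] := by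
  rw [mem_center_iff_coeff] at hz ⊢
  intro g h
  rw [MonoidAlgebra.coeff_mapRingHom, MonoidAlgebra.coeff_mapRingHom, hz]

theorem residueIdempotent_isIdempotentElem {e : O[G]} (he : IsBlockIdempotent e) :
    IsIdempotentElem (residueIdempotent e) :=
  he.idem.map (MonoidAlgebra.mapRingHom G (residue O))

variable [Finite G]

theorem exists_mapRingHom_eq {f : (ResidueField O)[G]}
    (hf : f ∈ Subalgebra.center (ResidueField O) (ResidueField O)[G]) :
    ∃ z ∈ Subalgebra.center O O[G], MonoidAlgebra.mapRingHom G (residue O) z = f := by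
  let s := Function.surjInv (residue_surjective (R := O))
  refine ⟨MonoidAlgebra.ofCoeff (Finsupp.equivFunOnFinite.symm fun g => s (f.coeff g)), ?_, ?_⟩
  · rw [mem_center_iff_coeff] at hf ⊢
    intro g h
    exact congrArg s (hf g h)
  · ext g
    rw [MonoidAlgebra.coeff_mapRingHom]
    exact Function.surjInv_eq residue_surjective _

theorem mapRingHom_classSum (c : G) :
    MonoidAlgebra.mapRingHom G (residue O) (classSum O c : O[G]) =
      (classSum (ResidueField O) c : (ResidueField O)[G]) := by
  classical
  ext y
  rw [MonoidAlgebra.coeff_mapRingHom]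
  change residue O (if IsConj c y then 1 else 0) = if IsConj c y then 1 else 0
  rw [apply_ite (residue O), map_one, map_zero]

variable {e : O[G]} {he : IsBlockIdempotent e}
  {φ : Subalgebra.center O O[G] →ₐ[O] ResidueField O}

/-- A character of the centre with values in the residue field factors through the reduction modulo
the maximal ideal. -/
theorem apply_eq_zero_of_mapRingHom_eq_zero (φ : Subalgebra.center O O[G] →ₐ[O] ResidueField O)
    {z : Subalgebra.center O O[G]}
    (hz : MonoidAlgebra.mapRingHom G (residue O) (z : O[G]) = 0) : φ z = 0 := by
  by_contra h
  obtain ⟨c, hc, -⟩ := exists_coeff_ne_zero φ (IsConj.setoid G) (fun _ _ h => h) z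
    (fun c d h => coeff_eq_of_isConj z.2 h) h
  refine hc ?_
  rw [← MonoidAlgebra.coeff_mapRingHom, hz]
  rfl

theorem residueIdempotent_ne_zero (hφ : IsCentralCharacter he φ) : residueIdempotent e ≠ 0 := by
  intro h
  have := apply_eq_zero_of_mapRingHom_eq_zero φ (z := ⟨e, he.central⟩) h
  rw [hφ.map_idem] at this
  exact one_ne_zero this

/-- The reduction of a block idempotent is primitive in the centre of the group algebra over the
residue field. -/
theorem eq_zero_or_eq_residueIdempotent (hφ : IsCentralCharacter he φ) {f : (ResidueField O)[G]}
    (hf : f ∈ Subalgebra.center (ResidueField O) (ResidueField O)[G]) (hi : IsIdempotentElem f)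
    (hef : residueIdempotent e * f = f) : f = 0 ∨ f = residueIdempotent e := by
  obtain ⟨z, hz, rfl⟩ := exists_mapRingHom_eq hf
  set r := MonoidAlgebra.mapRingHom G (residue O) with hr
  change r e * r z = r z at hef
  change r z = 0 ∨ r z = r e
  by_cases h : φ ⟨z, hz⟩ = 0
  · left
    have h1 : φ (1 - ⟨z, hz⟩) ≠ 0 := by
      rw [map_sub, map_one, h, sub_zero]
      exact one_ne_zero
    obtain ⟨b, hb⟩ := hφ.exists_mul_eq _ h1
    have h2 : (1 - z) * b = e := congrArg Subtype.val hb
    have h3 : r z * r e = 0 := by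
      rw [← h2, map_mul, map_sub, map_one, ← mul_assoc, mul_sub, mul_one, hi.eq, sub_self, zero_mul]
    rw [← hef, Subalgebra.mem_center_iff.mp hf, h3]
  · right
    obtain ⟨b, hb⟩ := hφ.exists_mul_eq _ h
    have h2 : z * b = e := congrArg Subtype.val hb
    rw [← hef, Subalgebra.mem_center_iff.mp hf, ← h2, map_mul, ← mul_assoc, hi.eq]

theorem hasDefectZero_of_isTraceFrom_bot (hφ : IsCentralCharacter he φ)
    (h : IsTraceFrom e (⊥ : Subgroup G)) : HasDefectZero e := by
  have : Fintype G := Fintype.ofFinite G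
  have : Fintype (G ⧸ (⊥ : Subgroup G)) := Fintype.ofFinite _
  obtain ⟨a, -, ha⟩ := h
  refine ⟨residueIdempotent_isIdempotentElem he, isSimpleRing_corner_of_sum_conj
    (a := MonoidAlgebra.mapRingHom G (residue O) a)
    (mapRingHom_mem_center he.central) _ (residueIdempotent_ne_zero hφ)
    (fun f => eq_zero_or_eq_residueIdempotent hφ) ?_⟩
  rw [relTrace, finsum_eq_sum_of_fintype,
    sum_quotient_bot fun g => MonoidAlgebra.of O G g * a * MonoidAlgebra.of O G g⁻¹] at ha
  refine Eq.trans ?_ (congrArg (MonoidAlgebra.mapRingHom G (residue O)) ha)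
  rw [map_sum]
  refine Finset.sum_congr rfl fun g _ => ?_
  rw [map_mul, map_mul]
  simp

/-- If the reduction of a block is a matrix algebra, then the block is a trace from the trivial
subgroup: the conjugates of a suitable `c` have a nonzero sum in the matrix algebra, so that the
centralizer of `c` has odd order and the central character does not vanish on the class sum. -/
theorem isTraceFrom_bot_of_hasDefectZero [CharP (ResidueField O) 2] [IsAlgClosed (ResidueField O)]
    (hφ : IsCentralCharacter he φ) (h : HasDefectZero e) : IsTraceFrom e (⊥ : Subgroup G) := by
  have : Fintype G := Fintype.ofFinite G
  have : Fintype (G ⧸ (⊥ : Subgroup G)) := Fintype.ofFinite _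
  obtain ⟨hi, hs⟩ := h
  have hcen := Subalgebra.mem_center_iff.mp (mapRingHom_mem_center he.central)
  have hfin : FiniteDimensional (ResidueField O) (ResidueField O)[G] :=
    Module.Finite.equiv (MonoidAlgebra.coeffLinearEquiv (S := ResidueField O)
      (R := ResidueField O) (M := G)).symm
  obtain ⟨n, hn, Φ, hΦ, hker⟩ := exists_algHom_matrix_of_isSimpleRing_corner
    (k := ResidueField O) (fun x => (hcen x).symm) hi hs
  obtain ⟨c, hc⟩ := exists_sum_conj_ne_zero Φ hΦ hker hi
  rw [← map_sum, ← sum_quotient_bot fun g => (MonoidAlgebra.single (g * c * g⁻¹) 1 :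
    (ResidueField O)[G]), sum_quotient_single_conj c bot_le, map_smul] at hc
  have hodd : ¬ 2 ∣ (⊥ : Subgroup G).relIndex (Subgroup.centralizer {c}) := by
    intro h2
    rw [(CharP.cast_eq_zero_iff (ResidueField O) 2 _).mpr h2, zero_smul] at hc
    exact hc rfl
  have hc0 : Φ (classSum (ResidueField O) c : (ResidueField O)[G]) ≠ 0 := right_ne_zero_of_smul hc
  obtain ⟨s, hs⟩ : ∃ s, Matrix.scalar (Fin n) s =
      Φ (classSum (ResidueField O) c : (ResidueField O)[G]) := by
    refine Matrix.mem_range_scalar_of_commute_single fun i j _ => ?_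
    obtain ⟨y, hy⟩ := hΦ (Matrix.single i j 1)
    rw [← hy]
    change Φ y * _ = _ * Φ y
    rw [← map_mul, ← map_mul, Subalgebra.mem_center_iff.mp (classSum (ResidueField O) c).2]
  have hs0 : s ≠ 0 := by
    rintro rfl
    rw [map_zero] at hs
    exact hc0 hs.symm
  -- The reduced class sum acts on the block as the scalar `s`, which is therefore the value of `φ`.
  obtain ⟨t, rfl⟩ := residue_surjective s
  have hφc : φ (classSum O c) = residue O t := by
    have h1 : φ (⟨e, he.central⟩ * (classSum O c - algebraMap O _ t)) = 0 := by
      refine apply_eq_zero_of_mapRingHom_eq_zero φ ?_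
      change MonoidAlgebra.mapRingHom G (residue O)
        (e * ((classSum O c : O[G]) - algebraMap O O[G] t)) = 0
      have h2 : MonoidAlgebra.mapRingHom G (residue O) (algebraMap O O[G] t) =
          algebraMap (ResidueField O) (ResidueField O)[G] (residue O t) :=
        congrArg (fun f : O →+* _ => f t) (MonoidAlgebra.mapRingHom_comp_algebraMap (residue O))
      rw [map_mul, map_sub, mapRingHom_classSum, h2]
      refine (hker _).mp ?_
      rw [map_sub, ← hs, AlgHom.commutes, sub_eq_zero]
      rfl
    rw [map_mul, hφ.map_idem, one_mul, map_sub, AlgHom.commutes, sub_eq_zero] at h1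
    exact h1
  obtain ⟨b, hb⟩ := hφ.exists_mul_eq _ (hφc.trans_ne hs0)
  exact isTraceFrom_of_classSum_mul c bot_le (isUnit_natCast_of_odd hodd) b.2
    (congrArg Subtype.val hb)

theorem eq_bot_iff_hasDefectZero [CharP (ResidueField O) 2] [IsAlgClosed (ResidueField O)]
    (hφ : IsCentralCharacter he φ) {D : Subgroup G} (hD : IsDefectGroup e D) :
    D = ⊥ ↔ HasDefectZero e := by
  constructor
  · rintro rfl
    exact hasDefectZero_of_isTraceFrom_bot hφ hD.1
  · intro h
    exact le_bot_iff.mp (hD.2 (isTraceFrom_bot_of_hasDefectZero hφ h) bot_le)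

end DefectZero

end BlockVertex

end
theorem mainTheorem4 {O G : Type*} [CommRing O] [IsDomain O] [IsLocalRing O]
    [IsAdicComplete (IsLocalRing.maximalIdeal O) O]
    [IsAlgClosed (IsLocalRing.ResidueField O)] [CharP (IsLocalRing.ResidueField O) 2]
    (hO : IsField O ∨ (IsDiscreteValuationRing O ∧ CharZero O))
    [Group G] [Finite G]
    (e : MonoidAlgebra O G) (he : BlockVertex.IsBlockIdempotent e)
    (D : Subgroup G) (hD : BlockVertex.IsDefectGroup e D) :
    (¬ BlockVertex.IsReal e →
      BlockVertex.IsVertex (BlockVertex.blockSumRep he) (D.map BlockVertex.diag)) ∧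
    (BlockVertex.IsReal e →
      ∃ x ∈ Subgroup.normalizer (D : Set G), x ^ 2 ∈ D ∧
        BlockVertex.IsVertex (BlockVertex.blockSumRep he)
          (D.map BlockVertex.diag ⊔
            Subgroup.zpowers (BlockVertex.diag x * BlockVertex.sigma))) ∧
    (BlockVertex.IsVertex (BlockVertex.blockSumRep he) (BlockVertex.SigmaSubgroup G) ↔
      BlockVertex.IsReal e ∧ BlockVertex.HasDefectZero e) := by
  have hN : IsNoetherianRing O := by
    rcases hO with h | ⟨h, -⟩
    · let _ := h.toField
      infer_instance
    · infer_instance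
  obtain ⟨φ, hφ⟩ := BlockVertex.exists_isCentralCharacter he
  refine ⟨BlockVertex.isVertex_of_not_isReal hφ hD, fun hr => ?_, fun hS => ?_, ?_⟩
  · obtain ⟨x, hx, hx2, hV⟩ := BlockVertex.exists_isVertex_of_isReal hφ hD hr
    have hV1 := hV 1
    rw [map_one] at hV1
    exact ⟨x, hx, hx2, (Subgroup.map_id _).subst (motive := BlockVertex.IsVertex _) hV1⟩
  · by_cases hr : BlockVertex.IsReal e
    · exact ⟨hr, (BlockVertex.eq_bot_iff_hasDefectZero hφ hD).mp
        (BlockVertex.defectGroup_eq_bot_of_isRelProjective hφ hD hS.minimal.1)⟩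
    · exact absurd hS (BlockVertex.not_isVertex_sigma_of_not_isReal hφ hD hr)
  · rintro ⟨hr, h0⟩
    obtain rfl := (BlockVertex.eq_bot_iff_hasDefectZero hφ hD).mpr h0
    exact BlockVertex.isVertex_sigma_of_eq_bot hφ hD hr
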